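/- **Setting.** Let $\mathcal Z$ be a connected graph with graph distance $\mathrm d$ whose balls grow polynomially: $|\{y:\mathrm d(x,y)\le L\}|\le C_d L^d$ for all vertices $x$ and integers $L\ge 1$. Let $V=(V(x;\omega))_{x\in\mathcal Z}$ be an IID real random field whose marginal distribution function $F_V$ satisfies $F_V(t+s)-F_V(t)\le C_W s$ for all $t\in\mathbb R$, $s\ge 0$, where $C_W\in(0,\infty)$. For a finite $\Lambda\subset\mathcal Z$ let $H_\Lambda=-\Delta_\Lambda+V$ be the discrete Schrödinger operator with Dirichlet boundary conditions, i.e. $(H_\Lambda f)(x)=(n(x)+V(x))f(x)-\sum_{y\in\Lambda,\ \mathrm d(x,y)=1}f(y)$ for $x\in\Lambda$, where $n(x)$ is the number of neighbours of $x$ in $\mathcal Z$; let $G_\Lambda(x,y;E)$ be the kernel of $(H_\Lambda-E)^{-1}$. Put $\alpha=\frac43$, $\delta=\frac14$, $\varrho=\frac13$, $\tau=\frac18$, and $L_{k+1}=\lfloor L_k^{\alpha}\rfloor$ for a given integer $L_0$. Balls are taken relative to connected (induced) subgraphs $\mathcal G\subseteq\mathcal Z$, with $\mathcal G=\mathcal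 Z$ allowed: $B^{\mathcal G}_L(u)=\{y\in\mathcal G:\mathrm d_{\mathcal G}(u,y)\le L\}$ for $u\in\mathcal G$, where $\mathrm d_{\mathcal G}$ is the graph distance of $\mathcal G$. For $E\in\mathbb R$ and $m>0$, the ball $B=B^{\mathcal G}_L(u)$ is called *$(E,m)$-nonsingular* if $E$ is not an eigenvalue of $H_B$ and $$C_d^2L^d\,|G_B(x,y;E)|\le e^{-\gamma(m,L)\,\mathrm d_{\mathcal G}(x,y)},\qquad \gamma(m,L)=m(1+L^{-\tau}),$$ for all $x,y\in B$ with $\mathrm d_{\mathcal G}(x,y)\ge L^{(1+\varrho)/\alpha}$, and *$(E,m)$-singular* otherwise. For $k\ge 0$ and $E\in\mathbb R$ consider the property > $\mathbf{SS}(k,E)$: for every connected subgraph $\mathcal G\subseteq\mathcal Z$ and every $u\in\mathcal G$, $\ \mathbb P\{B^{\mathcal G}_{L_k}(u)\text{ is }(E,m)\text{-singular}\}\le e^{-L_k^{\delta}}$. **Theorem.** For all $d$, $C_d$, $C_W>0$ and $m_0>0$ there is an integer $L_{\min}$, depending only on these four numbers, such that for all $\mathcal Z$ and $V$ as above, all $m\ge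 m_0$, all integers $L_0\ge L_{\min}$, all $k\ge 0$ and all $E\in\mathbb R$: $\mathbf{SS}(k,E)$ implies $\mathbf{SS}(k+1,E)$. -/

import Mathlib

open MeasureTheory ProbabilityTheory

noncomputable section

namespace FixedEnergyMSA

/-! The scaling parameters. -/

/-- The scale growth exponent `α = 4/3`. -/
def α : ℝ := 4 / 3

/-- The exponent `δ = 1/4` of the sub-exponential probability bound. -/
def δ : ℝ := 1 / 4

/-- The exponent `ϱ = 1/3`, used in the definition of non-singular balls. -/
def ϱ : ℝ := 1 / 3

/-- The exponent `τ = 1/8`, used in the definition of `γ(m, L)`. -/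
def τ : ℝ := 1 / 8

/-- The integer length scales: `L_{k+1} = ⌊L_k ^ α⌋`, starting from `L_0`. -/
def scale (L₀ : ℕ) : ℕ → ℕ
  | 0 => L₀
  | k + 1 => ⌊(scale L₀ k : ℝ) ^ α⌋₊

/-- `γ(m, L) = m (1 + L ^ (-τ))`. -/
def γ (m : ℝ) (L : ℕ) : ℝ := m * (1 + (L : ℝ) ^ (-τ))

/-! Graphs, distances and balls. -/

/-- Polynomially bounded growth of balls: `|B_L(x)| ≤ C L ^ d` for all vertices `x` and all
`L ≥ 1`. -/
def PolynomialGrowth {Z : Type*} (𝒵 : SimpleGraph Z) (C d : ℝ) : Prop :=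
  ∀ (x : Z) (L : ℕ), 1 ≤ L →
    {y : Z | 𝒵.dist x y ≤ L}.Finite ∧ ({y : Z | 𝒵.dist x y ≤ L}.ncard : ℝ) ≤ C * (L : ℝ) ^ d

/-- The graph distance `d_G` of the induced subgraph on the vertex set `G`: for `x, y ∈ G`, the
length of a shortest path from `x` to `y` that stays in `G`. It is only used for `x, y ∈ G` with
`G` connected. (`spanningCoe` adds the vertices outside `G` as isolated points, so that the
distance can be applied to vertices of `Z`.) -/
def relDist {Z : Type*} (𝒵 : SimpleGraph Z) (G : Set Z) (x y : Z) : ℕ :=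
  (𝒵.induce G).spanningCoe.dist x y

/-- The ball `B_R(u)` relative to the metric space `(G, d_G)`. -/
def relBall {Z : Type*} (𝒵 : SimpleGraph Z) (G : Set Z) (u : Z) (R : ℕ) : Set Z :=
  {y : Z | y ∈ G ∧ relDist 𝒵 G u y ≤ R}

/-! Discrete Schrödinger operators and Green functions. -/

open Classical in
/-- The discrete Schrödinger operator `H_Λ = -Δ_Λ + V` in a finite set `Λ` with Dirichlet boundary
conditions: the diagonal entries are `n(x) + V(x)`, where `n(x)` is the coordination number of `x`
in the whole graph, and the off-diagonal entries are `-1` for nearest neighbours in `Λ`. -/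
def hamiltonian {Z : Type*} (𝒵 : SimpleGraph Z) (V : Z → ℝ) (Λ : Finset Z) : Matrix Λ Λ ℝ :=
  Matrix.of fun x y =>
    (if x = y then ((𝒵.neighborSet (x : Z)).ncard : ℝ) + V x else 0) -
      (if 𝒵.Adj (x : Z) (y : Z) then 1 else 0)

open Classical in
/-- The Green function `G_Λ(x, y; E)`, the kernel of `(H_Λ - E)⁻¹`; meaningful for `E` outside the
spectrum of `H_Λ`. -/
def greenFunction {Z : Type*} (𝒵 : SimpleGraph Z) (V : Z → ℝ) (Λ : Finset Z) (E : ℝ) :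
    Matrix Λ Λ ℝ :=
  (hamiltonian 𝒵 V Λ - E • (1 : Matrix Λ Λ ℝ))⁻¹

open Classical in
/-- `Λ`, a ball of radius `L` relative to `G`, is `(E, m)`-nonsingular: `E` is not an eigenvalue
of `H_Λ`, and `C ^ 2 L ^ d |G_Λ(x, y; E)| ≤ exp (-γ(m, L) d_G(x, y))` for all `x, y ∈ Λ` with
`d_G(x, y) ≥ L ^ ((1 + ϱ) / α)`. -/
def IsNonsingular {Z : Type*} (𝒵 : SimpleGraph Z) (C d : ℝ) (V : Z → ℝ) (E m : ℝ)
    (G : Set Z) (L : ℕ) (Λ : Finset Z) : Prop :=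
  E ∉ spectrum ℝ (hamiltonian 𝒵 V Λ) ∧
    ∀ x y : Λ, (L : ℝ) ^ ((1 + ϱ) / α) ≤ (relDist 𝒵 G x y : ℝ) →
      C ^ 2 * (L : ℝ) ^ d * |greenFunction 𝒵 V Λ E x y| ≤
        Real.exp (-(γ m L * (relDist 𝒵 G x y : ℝ)))

/-! The random potential and the induction property. -/

/-- `V` is an IID random field whose marginal distribution function `F` is Lipschitz:
`F(t + s) - F(t) ≤ C_W s` for all `t` and all `s ≥ 0`. -/
structure IsIIDPotential {Z Ω : Type*} [MeasurableSpace Ω] (μ : Measure Ω) (V : Z → Ω → ℝ)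
    (C_W : ℝ) : Prop where
  measurable : ∀ x, Measurable (V x)
  indep : iIndepFun V μ
  identDistrib : ∀ x y, IdentDistrib (V x) (V y) μ μ
  lipschitz : ∀ (x : Z) (t s : ℝ), 0 ≤ s →
    cdf (μ.map (V x)) (t + s) - cdf (μ.map (V x)) t ≤ C_W * s

/-- The fixed-energy bound at scale `L` and energy `E`: every ball of radius `L` (relative to any
connected subgraph `G`, in particular to the whole graph) is `(E, m)`-singular with probability at
most `exp (-L ^ δ)`. -/
def SingularBound {Z Ω : Type*} [MeasurableSpace Ω] (𝒵 : SimpleGraph Z) (C d : ℝ)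
    (μ : Measure Ω) (V : Z → Ω → ℝ) (m : ℝ) (L : ℕ) (E : ℝ) : Prop :=
  ∀ (G : Set Z), (𝒵.induce G).Connected → ∀ u ∈ G, ∀ Λ : Finset Z,
    (Λ : Set Z) = relBall 𝒵 G u L →
      μ.real {ω | ¬ IsNonsingular 𝒵 C d (fun x => V x ω) E m G L Λ} ≤
        Real.exp (-((L : ℝ) ^ δ))

end FixedEnergyMSA

end

namespace FixedEnergyMSA

/-! ### Distances and balls in induced subgraphs -/

section Graph

variable {Z : Type*} {𝒵 : SimpleGraph Z} {G : Set Z}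

/-! Put `t = L ^ (1 / 24)`, so that `L = t ^ 24`, `L ^ δ = t ^ 6`, the next scale is `L' = ⌊t ^ 32⌋`
and `L' ^ δ ≤ t ^ 8`. A ball `Λ` of radius `L'` turns out to be nonsingular outside two rare events.

Resonance: with `ε = exp (-2 t ^ 8)`, the set `Λ` or some ball inside it violates `ε ‖ψ‖ ≤ ‖(H - E)
ψ‖` in the sup norm. The Wegner estimate `IsIIDPotential.measure_not_isNonresonant_le` bounds each
such probability by `ε` times a volume factor.

Multiple singularity: some `n = ⌈4 t ^ 2⌉` pairwise disjoint balls of radius `L` in `Λ` are all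
singular. Disjoint balls are independent, so the probability is at most `(|Λ| exp (-t ^ 6)) ^ n ≤
exp (-2 t ^ 8)`. Here the induction hypothesis is applied with `Λ` itself as the connected subgraph.

Off both events, let `f = G_Λ(·, y)`, let `M r` be its maximal modulus on the ball of radius `r`
about `x`, and let `D ≥ L'` be the distance of `x` and `y`. If all `L`-balls centred on the sphere
of radius `r + 1` are nonsingular, then `|f| ≤ exp (-γ L) M (r + L + 2)` on that sphere, and
nonresonance of the `r`-ball carries the bound inside at the cost of a factor `C / ε`
(`exists_greenFunction_decay`). At most `n (4 L + 2)` radii have to be skipped (`card_radii_le`).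
Skipping costs a fraction of order `t ^ (-6)` of the decay, and resonance one of order `t ^ (-16) /
m`. Both fit into the gap between the old rate `m (1 + t ^ (-3))` and the new one, at most `m (1 + 2
t ^ (-4))` (`exponent_le`). -/

lemma spanningCoe_induce_adj {x y : Z} :
    (𝒵.induce G).spanningCoe.Adj x y ↔ x ∈ G ∧ y ∈ G ∧ 𝒵.Adj x y := by
  simp only [SimpleGraph.map_adj, SimpleGraph.comap_adj, Function.Embedding.subtype_apply,
    Subtype.exists]
  constructor
  · rintro ⟨a, ha, b, hb, h, rfl, rfl⟩
    exact ⟨ha, hb, h⟩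
  · rintro ⟨ha, hb, h⟩
    exact ⟨x, ha, y, hb, h, rfl, rfl⟩

lemma reachable_spanningCoe (hG : (𝒵.induce G).Connected) {x y : Z} (hx : x ∈ G) (hy : y ∈ G) :
    (𝒵.induce G).spanningCoe.Reachable x y :=
  (hG.preconnected ⟨x, hx⟩ ⟨y, hy⟩).map (SimpleGraph.Embedding.spanningCoe _).toHom

lemma relDist_self (x : Z) : relDist 𝒵 G x x = 0 := SimpleGraph.dist_self

lemma relDist_comm (x y : Z) : relDist 𝒵 G x y = relDist 𝒵 G y x := SimpleGraph.dist_comm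

/-- `SimpleGraph.dist` is `0` between unreachable vertices, so the inequality needs `x` and `y` in
one component; then `z` is reachable from both or from neither. -/
lemma relDist_triangle (hG : (𝒵.induce G).Connected) {x y z : Z} (hx : x ∈ G) (hy : y ∈ G) :
    relDist 𝒵 G x z ≤ relDist 𝒵 G x y + relDist 𝒵 G y z :=
  (reachable_spanningCoe hG hx hy).dist_triangle_left z

lemma relDist_adj_le {x y z : Z} (hG : (𝒵.induce G).Connected) (hx : x ∈ G) (hy : y ∈ G)
    (hz : z ∈ G) (h : 𝒵.Adj y z) : relDist 𝒵 G x z ≤ relDist 𝒵 G x y + 1 := by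
  refine (relDist_triangle hG hx hy).trans ?_
  have : (𝒵.induce G).spanningCoe.dist y z = 1 :=
    SimpleGraph.dist_eq_one_iff_adj.2 (spanningCoe_induce_adj.2 ⟨hy, hz, h⟩)
  simp [relDist, this]

lemma relDist_anti {G' : Set Z} (hG : (𝒵.induce G).Connected) (hsub : G ⊆ G') {x y : Z}
    (hx : x ∈ G) (hy : y ∈ G) : relDist 𝒵 G' x y ≤ relDist 𝒵 G x y := by
  refine (reachable_spanningCoe hG hx hy).dist_anti ?_
  intro a b h
  rw [spanningCoe_induce_adj] at h ⊢
  exact ⟨hsub h.1, hsub h.2.1, h.2.2⟩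

lemma dist_le_relDist (hG : (𝒵.induce G).Connected) {x y : Z} (hx : x ∈ G) (hy : y ∈ G) :
    𝒵.dist x y ≤ relDist 𝒵 G x y :=
  (reachable_spanningCoe hG hx hy).dist_anti (𝒵.spanningCoe_induce_le G)

lemma exists_adj_relDist_eq (hG : (𝒵.induce G).Connected) {u x : Z} (hu : u ∈ G) (hx : x ∈ G)
    {r : ℕ} (h : relDist 𝒵 G u x = r + 1) :
    ∃ y ∈ G, 𝒵.Adj y x ∧ relDist 𝒵 G u y ≤ r := by
  obtain ⟨p, hp⟩ := (reachable_spanningCoe hG hx hu).exists_walk_length_eq_dist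
  have hp' : p.length = r + 1 := by rw [hp, ← h]; exact SimpleGraph.dist_comm
  cases p with
  | nil => simp at hp'
  | @cons _ y _ hadj q =>
    rw [spanningCoe_induce_adj] at hadj
    refine ⟨y, hadj.2.1, hadj.2.2.symm, ?_⟩
    have : q.length = r := by simpa using hp'
    rw [relDist_comm, ← this]
    exact SimpleGraph.dist_le q

lemma self_mem_relBall {u : Z} (hu : u ∈ G) (R : ℕ) : u ∈ relBall 𝒵 G u R :=
  ⟨hu, by simp [relDist_self]⟩

/-- A geodesic from the centre never leaves the ball. This makes a ball an admissible subgraph for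
the induction hypothesis. -/
lemma connected_induce_relBall (hG : (𝒵.induce G).Connected) {u : Z} (hu : u ∈ G) (R : ℕ) :
    (𝒵.induce (relBall 𝒵 G u R)).Connected := by
  have key : ∀ r : ℕ, ∀ x (hx : x ∈ relBall 𝒵 G u R), relDist 𝒵 G u x ≤ r →
      (𝒵.induce (relBall 𝒵 G u R)).Reachable ⟨u, self_mem_relBall hu R⟩ ⟨x, hx⟩ := by
    intro r
    induction r with
    | zero =>
      intro x hx h
      have : u = x :=
        ((reachable_spanningCoe hG hu hx.1).dist_eq_zero_iff).1 (Nat.le_zero.1 h)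
      subst this
      exact SimpleGraph.Reachable.refl _
    | succ r ih =>
      intro x hx h
      rcases Nat.lt_or_ge (relDist 𝒵 G u x) (r + 1) with h' | h'
      · exact ih x hx (Nat.lt_succ_iff.1 h')
      · have heq := le_antisymm h h'
        obtain ⟨y, hyG, hadj, hy⟩ := exists_adj_relDist_eq hG hu hx.1 heq
        have hyB : y ∈ relBall 𝒵 G u R := ⟨hyG, by have := hx.2; omega⟩
        refine (ih y hyB hy).trans (SimpleGraph.Adj.reachable ?_)
        simpa using hadj
  have : Nonempty (relBall 𝒵 G u R) := ⟨⟨u, self_mem_relBall hu R⟩⟩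
  exact ⟨fun x y => (key _ x.1 x.2 le_rfl).symm.trans (key _ y.1 y.2 le_rfl)⟩

variable {C d : ℝ}

lemma PolynomialGrowth.card_le (hgr : PolynomialGrowth 𝒵 C d) {x : Z} {L : ℕ} (hL : 1 ≤ L)
    {s : Finset Z} (hs : ∀ y ∈ s, 𝒵.dist x y ≤ L) : (s.card : ℝ) ≤ C * (L : ℝ) ^ d := by
  obtain ⟨hfin, hcard⟩ := hgr x L hL
  refine le_trans ?_ hcard
  rw [← Set.ncard_coe_finset s]
  exact_mod_cast Set.ncard_le_ncard (fun y hy => hs y hy) hfin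

lemma PolynomialGrowth.one_le [Nonempty Z] (hgr : PolynomialGrowth 𝒵 C d) : 1 ≤ C := by
  have x : Z := Classical.arbitrary Z
  simpa using hgr.card_le (x := x) le_rfl (s := {x}) (by simp)

lemma PolynomialGrowth.card_neighbors_le (hgr : PolynomialGrowth 𝒵 C d) (x : Z)
    {s : Finset Z} (hs : ∀ y ∈ s, 𝒵.Adj x y) : (s.card : ℝ) ≤ C := by
  simpa using hgr.card_le (x := x) le_rfl (s := s)
    (fun y hy => (SimpleGraph.dist_eq_one_iff_adj.2 (hs y hy)).le)

lemma PolynomialGrowth.card_relBall_le (hgr : PolynomialGrowth 𝒵 C d)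
    (hG : (𝒵.induce G).Connected) {u : Z} (hu : u ∈ G) {L : ℕ} (hL : 1 ≤ L) {Λ : Finset Z}
    (hΛ : (Λ : Set Z) = relBall 𝒵 G u L) : (Λ.card : ℝ) ≤ C * (L : ℝ) ^ d := by
  refine hgr.card_le (x := u) hL fun y hy => ?_
  have hy' : y ∈ relBall 𝒵 G u L := hΛ ▸ (Finset.mem_coe.2 hy)
  exact (dist_le_relDist hG hu hy'.1).trans hy'.2

end Graph

/-! ### Nonresonance, Green functions and boundary estimates -/

section GreenFunction

open Classical Matrix

variable {Z : Type*} {𝒵 : SimpleGraph Z} {V : Z → ℝ} {E ε : ℝ} {Λ Λ' : Finset Z}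

/-- The action of `H_Λ - E` on (the restriction to `Λ` of) a function on the whole vertex set. -/
noncomputable def schrodingerApply (𝒵 : SimpleGraph Z) (V : Z → ℝ) (E : ℝ) (Λ : Finset Z)
    (f : Z → ℝ) (x : Z) : ℝ :=
  (((𝒵.neighborSet x).ncard : ℝ) + V x - E) * f x - ∑ y ∈ Λ with 𝒵.Adj x y, f y

/-- `Λ` is `(E, ε)`-nonresonant: `H_Λ - E` is bounded below by `ε` in the sup norm. -/
def IsNonresonant (𝒵 : SimpleGraph Z) (V : Z → ℝ) (E ε : ℝ) (Λ : Finset Z) : Prop :=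
  ∀ ψ : Λ → ℝ, ε * ‖ψ‖ ≤ ‖(hamiltonian 𝒵 V Λ - E • (1 : Matrix Λ Λ ℝ)) *ᵥ ψ‖

lemma mulVec_eq_schrodingerApply (f : Z → ℝ) (x : Λ) :
    ((hamiltonian 𝒵 V Λ - E • (1 : Matrix Λ Λ ℝ)) *ᵥ fun z : Λ => f z) x =
      schrodingerApply 𝒵 V E Λ f x := by
  rw [Matrix.sub_mulVec, Matrix.smul_mulVec, Matrix.one_mulVec]
  simp only [hamiltonian, Pi.sub_apply, Matrix.mulVec, dotProduct, Matrix.of_apply, sub_mul,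
    ite_mul, zero_mul, one_mul, Finset.sum_sub_distrib, Finset.sum_ite_eq, Finset.mem_univ,
    if_true, Pi.smul_apply, smul_eq_mul, schrodingerApply]
  have : ∑ y : Λ, (if 𝒵.Adj (x : Z) (y : Z) then f y else 0) = ∑ y ∈ Λ with 𝒵.Adj x y, f y := by
    rw [Finset.sum_filter, ← Finset.sum_coe_sort Λ]
  rw [this]
  ring

/-- Shrinking the set drops the hopping across the boundary. A solution on `Λ` thus becomes, on
`Λ'`, a solution with a source made of its outer boundary values; this plays the role of the
geometric resolvent identity. -/
lemma schrodingerApply_subset (h : Λ' ⊆ Λ) (f : Z → ℝ) (x : Z) :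
    schrodingerApply 𝒵 V E Λ' f x =
      schrodingerApply 𝒵 V E Λ f x + ∑ y ∈ Λ \ Λ' with 𝒵.Adj x y, f y := by
  have : ∑ y ∈ Λ with 𝒵.Adj x y, f y =
      ∑ y ∈ Λ' with 𝒵.Adj x y, f y + ∑ y ∈ Λ \ Λ' with 𝒵.Adj x y, f y := by
    simp only [Finset.sum_filter]
    rw [add_comm, Finset.sum_sdiff h]
  simp only [schrodingerApply, this]
  ring

lemma abs_boundary_sum_le {C d M : ℝ} (hgr : PolynomialGrowth 𝒵 C d) (hM : 0 ≤ M) (f : Z → ℝ)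
    (x : Z) (s : Finset Z) (h : ∀ y ∈ s, 𝒵.Adj x y → |f y| ≤ M) :
    |∑ y ∈ s with 𝒵.Adj x y, f y| ≤ C * M := by
  calc |∑ y ∈ s with 𝒵.Adj x y, f y| ≤ ∑ y ∈ s with 𝒵.Adj x y, |f y| :=
        Finset.abs_sum_le_sum_abs _ _
    _ ≤ ∑ y ∈ s with 𝒵.Adj x y, M := Finset.sum_le_sum fun y hy => by
        rw [Finset.mem_filter] at hy
        exact h y hy.1 hy.2
    _ = ((s.filter (𝒵.Adj x)).card : ℝ) * M := by simp
    _ ≤ C * M := mul_le_mul_of_nonneg_right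
        (hgr.card_neighbors_le x fun y hy => (Finset.mem_filter.1 hy).2) hM

lemma notMem_spectrum_iff_isUnit_det :
    E ∉ spectrum ℝ (hamiltonian 𝒵 V Λ) ↔
      IsUnit (hamiltonian 𝒵 V Λ - E • (1 : Matrix Λ Λ ℝ)).det := by
  rw [spectrum.notMem_iff, Algebra.algebraMap_eq_smul_one, ← Matrix.isUnit_iff_isUnit_det,
    ← IsUnit.neg_iff, neg_sub]

lemma IsNonresonant.notMem_spectrum (hε : 0 < ε) (h : IsNonresonant 𝒵 V E ε Λ) :
    E ∉ spectrum ℝ (hamiltonian 𝒵 V Λ) := by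
  rw [notMem_spectrum_iff_isUnit_det, isUnit_iff_ne_zero]
  intro h0
  obtain ⟨v, hv, hv0⟩ := Matrix.exists_mulVec_eq_zero_iff.2 h0
  have := h v
  rw [hv0, norm_zero] at this
  have : 0 < ε * ‖v‖ := mul_pos hε (norm_pos_iff.2 hv)
  linarith

/-- The column `G_Λ(·, y; E)`, extended by zero to the whole vertex set. -/
noncomputable def greenColumn (𝒵 : SimpleGraph Z) (V : Z → ℝ) (E : ℝ) (Λ : Finset Z) (y : Λ)
    (x : Z) : ℝ :=
  if h : x ∈ Λ then greenFunction 𝒵 V Λ E ⟨x, h⟩ y else 0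

lemma greenColumn_coe (x y : Λ) :
    greenColumn 𝒵 V E Λ y x = greenFunction 𝒵 V Λ E x y := by
  simp [greenColumn]

lemma mulVec_greenColumn (hE : E ∉ spectrum ℝ (hamiltonian 𝒵 V Λ)) (y : Λ) :
    (hamiltonian 𝒵 V Λ - E • (1 : Matrix Λ Λ ℝ)) *ᵥ (fun z : Λ => greenColumn 𝒵 V E Λ y z) =
      Pi.single y 1 := by
  rw [notMem_spectrum_iff_isUnit_det] at hE
  have : (fun z : Λ => greenColumn 𝒵 V E Λ y z) =
      (hamiltonian 𝒵 V Λ - E • (1 : Matrix Λ Λ ℝ))⁻¹ *ᵥ Pi.single y 1 := by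
    ext z
    rw [greenColumn_coe, greenFunction, Matrix.mulVec_single_one, Matrix.col_apply]
  rw [this, Matrix.mulVec_mulVec, Matrix.mul_nonsing_inv _ hE, Matrix.one_mulVec]

lemma schrodingerApply_greenColumn (hE : E ∉ spectrum ℝ (hamiltonian 𝒵 V Λ)) (y : Λ) {x : Z}
    (hx : x ∈ Λ) (hxy : x ≠ y) :
    schrodingerApply 𝒵 V E Λ (greenColumn 𝒵 V E Λ y) x = 0 := by
  have := mulVec_eq_schrodingerApply (𝒵 := 𝒵) (V := V) (E := E) (greenColumn 𝒵 V E Λ y) ⟨x, hx⟩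
  rw [mulVec_greenColumn hE y, Pi.single_eq_of_ne (fun h => hxy (congrArg Subtype.val h))] at this
  exact this.symm

/-- `H_Λ - E` maps the column to a delta function, whose sup norm is at most `1`. -/
lemma IsNonresonant.abs_greenColumn_le (hε : 0 < ε) (h : IsNonresonant 𝒵 V E ε Λ) (y : Λ)
    (x : Z) : |greenColumn 𝒵 V E Λ y x| ≤ 1 / ε := by
  by_cases hx : x ∈ Λ
  · have h1 := h fun z : Λ => greenColumn 𝒵 V E Λ y z
    rw [mulVec_greenColumn (h.notMem_spectrum hε) y] at h1
    have h2 : ‖(Pi.single y 1 : Λ → ℝ)‖ ≤ 1 := by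
      refine (pi_norm_le_iff_of_nonneg zero_le_one).2 fun z => ?_
      by_cases hz : z = y
      · subst hz; simp
      · simp [Pi.single_eq_of_ne hz]
    have h3 := norm_le_pi_norm (fun z : Λ => greenColumn 𝒵 V E Λ y z) ⟨x, hx⟩
    rw [Real.norm_eq_abs] at h3
    rw [le_div_iff₀ hε, mul_comm]
    exact (mul_le_mul_of_nonneg_left h3 hε.le).trans (h1.trans h2)
  · simp only [greenColumn, hx, dite_false, abs_zero]
    positivity

/-- A solution in a nonresonant set is controlled by its values on the outer boundary. -/
lemma IsNonresonant.abs_le_of_boundary {C d M : ℝ} (hgr : PolynomialGrowth 𝒵 C d) (hC : 0 ≤ C)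
    (hM : 0 ≤ M) (h : IsNonresonant 𝒵 V E ε Λ') (hε : 0 < ε) (hsub : Λ' ⊆ Λ) {f : Z → ℝ}
    (hf : ∀ x ∈ Λ', schrodingerApply 𝒵 V E Λ f x = 0)
    (hb : ∀ x ∈ Λ', ∀ w ∈ Λ \ Λ', 𝒵.Adj x w → |f w| ≤ M) {x : Z} (hx : x ∈ Λ') :
    |f x| ≤ C / ε * M := by
  have h1 := h fun z : Λ' => f z
  have h2 : ‖(hamiltonian 𝒵 V Λ' - E • (1 : Matrix Λ' Λ' ℝ)) *ᵥ fun z : Λ' => f z‖ ≤ C * M := by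
    refine (pi_norm_le_iff_of_nonneg (by positivity)).2 fun z => ?_
    rw [mulVec_eq_schrodingerApply, schrodingerApply_subset hsub, hf z z.2, zero_add,
      Real.norm_eq_abs]
    exact abs_boundary_sum_le hgr hM f z _ (hb z z.2)
  have h3 := norm_le_pi_norm (fun z : Λ' => f z) ⟨x, hx⟩
  rw [Real.norm_eq_abs] at h3
  rw [div_mul_eq_mul_div, le_div_iff₀ hε, mul_comm]
  exact (mul_le_mul_of_nonneg_left h3 hε.le).trans (h1.trans h2)

/-- Decay is therefore available exactly from distance `L` on, which is the distance from the centre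
of an `L`-ball to its inner boundary. -/
lemma range_exponent : (1 + ϱ) / α = 1 := by norm_num [ϱ, α]

/-- A solution at the centre of a nonsingular ball is controlled by its values on the sphere
surrounding the ball. -/
lemma IsNonsingular.abs_le_of_sphere {C d m M : ℝ} {L : ℕ} (hgr : PolynomialGrowth 𝒵 C d)
    (hC : 0 < C) (hL : 1 ≤ L) (hM : 0 ≤ M) (hconn : (𝒵.induce (Λ : Set Z)).Connected) {x : Z}
    (hx : x ∈ Λ) (hΛ' : (Λ' : Set Z) = relBall 𝒵 (Λ : Set Z) x L)
    (h : IsNonsingular 𝒵 C d V E m (Λ : Set Z) L Λ') {f : Z → ℝ}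
    (hf : ∀ z ∈ Λ', schrodingerApply 𝒵 V E Λ f z = 0)
    (hb : ∀ w ∈ Λ, relDist 𝒵 (Λ : Set Z) x w = L + 1 → |f w| ≤ M) :
    |f x| ≤ Real.exp (-(γ m L * L)) * M := by
  have hmem : ∀ z, z ∈ Λ' ↔ z ∈ Λ ∧ relDist 𝒵 (Λ : Set Z) x z ≤ L := fun z => by
    rw [← Finset.mem_coe, hΛ']; rfl
  have hsub : Λ' ⊆ Λ := fun z hz => ((hmem z).1 hz).1
  have hxΛ' : x ∈ Λ' := (hmem x).2 ⟨hx, by simp [relDist_self]⟩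
  obtain ⟨hE, hG⟩ := h
  rw [notMem_spectrum_iff_isUnit_det] at hE
  set A := hamiltonian 𝒵 V Λ' - E • (1 : Matrix Λ' Λ' ℝ) with hA
  set g : Λ' → ℝ := A *ᵥ fun z : Λ' => f z with hg
  have hfx : f x = ∑ z : Λ', greenFunction 𝒵 V Λ' E ⟨x, hxΛ'⟩ z * g z := by
    have : (A⁻¹ *ᵥ g) ⟨x, hxΛ'⟩ = f x := by
      rw [hg, Matrix.mulVec_mulVec, Matrix.nonsing_inv_mul _ hE, Matrix.one_mulVec]
    rw [← this]
    rfl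
  have hLpos : (0 : ℝ) < (L : ℝ) ^ d := Real.rpow_pos_of_pos (by exact_mod_cast hL) d
  -- The source `g` vanishes at distance less than `L` from `x`, where all neighbours in `Λ` still
  -- lie in `Λ'`; only points at distance exactly `L` contribute.
  have hterm : ∀ z : Λ', |greenFunction 𝒵 V Λ' E ⟨x, hxΛ'⟩ z * g z| ≤
      Real.exp (-(γ m L * L)) / (C ^ 2 * (L : ℝ) ^ d) * (C * M) := by
    intro z
    have hgz : g z = ∑ w ∈ Λ \ Λ' with 𝒵.Adj z w, f w := by
      rw [hg, hA, mulVec_eq_schrodingerApply, schrodingerApply_subset hsub, hf z z.2, zero_add]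
    have hzx := (hmem z).1 z.2
    by_cases hz : relDist 𝒵 (Λ : Set Z) x z = L
    · have h1 := hG ⟨x, hxΛ'⟩ z (by rw [range_exponent, Real.rpow_one, hz])
      rw [hz] at h1
      have h2 : |g z| ≤ C * M := by
        rw [hgz]
        refine abs_boundary_sum_le hgr hM f z _ fun w hw hadj => ?_
        rw [Finset.mem_sdiff] at hw
        refine hb w hw.1 (le_antisymm ?_ ?_)
        · rw [← hz]
          exact relDist_adj_le hconn hx hzx.1 hw.1 hadj
        · by_contra hlt
          exact hw.2 ((hmem w).2 ⟨hw.1, by omega⟩)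
      rw [abs_mul]
      refine mul_le_mul ?_ h2 (abs_nonneg _) (by positivity)
      rw [le_div_iff₀ (by positivity), mul_comm]
      exact h1
    · have h0 : g z = 0 := by
        rw [hgz]
        refine Finset.sum_eq_zero fun w hw => ?_
        rw [Finset.mem_filter, Finset.mem_sdiff] at hw
        exfalso
        refine hw.1.2 ((hmem w).2 ⟨hw.1.1, ?_⟩)
        have := relDist_adj_le hconn hx hzx.1 hw.1.1 hw.2
        have := hzx.2
        omega
      rw [h0, mul_zero, abs_zero]
      positivity
  -- The volume `C * L ^ d` and the at most `C` neighbours counted in `hterm` cancel the prefactor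
  -- `C ^ 2 * L ^ d` of nonsingularity.
  have hcard := hgr.card_relBall_le hconn hx hL hΛ'
  calc |f x| ≤ ∑ z : Λ', |greenFunction 𝒵 V Λ' E ⟨x, hxΛ'⟩ z * g z| := by
        rw [hfx]; exact Finset.abs_sum_le_sum_abs _ _
    _ ≤ ∑ z : Λ', Real.exp (-(γ m L * L)) / (C ^ 2 * (L : ℝ) ^ d) * (C * M) :=
        Finset.sum_le_sum fun z _ => hterm z
    _ = (Λ'.card : ℝ) * (Real.exp (-(γ m L * L)) / (C ^ 2 * (L : ℝ) ^ d) * (C * M)) := by simp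
    _ ≤ (C * (L : ℝ) ^ d) * (Real.exp (-(γ m L * L)) / (C ^ 2 * (L : ℝ) ^ d) * (C * M)) :=
        mul_le_mul_of_nonneg_right hcard (by positivity)
    _ = Real.exp (-(γ m L * L)) * M := by field_simp

end GreenFunction

/-! ### Radial iteration -/

section Iteration

/-- Iterating a contraction over all radii outside a finite exceptional set. -/
lemma exists_iterate_bound {M : ℕ → ℝ} {q K : ℝ} {D L : ℕ} {bad : Finset ℕ} (hq : 0 ≤ q)
    (hmono : Monotone M) (hK : ∀ r, M r ≤ K)
    (hgood : ∀ r, r + L + 1 < D → r ∉ bad → M r ≤ q * M (r + L + 2)) :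
    ∃ N : ℕ, M 0 ≤ q ^ N * K ∧ D ≤ N * (L + 2) + bad.card + L + 1 := by
  -- A good radius advances by `L + 2` and gains a factor `q`. A bad one is passed by monotonicity,
  -- advancing by `1`, and is charged to itself because it leaves the filtered set.
  have key : ∀ j r, D ≤ r + j → ∃ N : ℕ, M r ≤ q ^ N * K ∧
      D ≤ r + N * (L + 2) + (bad.filter (r ≤ ·)).card + L + 1 := by
    intro j
    induction j using Nat.strong_induction_on with
    | _ j ih =>
      intro r hr
      by_cases h : r + L + 1 < D
      · by_cases hb : r ∈ bad
        · obtain ⟨N, h1, h2⟩ := ih (j - 1) (by omega) (r + 1) (by omega)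
          refine ⟨N, (hmono (Nat.le_succ r)).trans h1, ?_⟩
          have : (bad.filter (r + 1 ≤ ·)).card < (bad.filter (r ≤ ·)).card := by
            refine Finset.card_lt_card (Finset.ssubset_iff_of_subset ?_ |>.2 ⟨r, ?_, ?_⟩)
            · intro a ha
              rw [Finset.mem_filter] at ha ⊢
              exact ⟨ha.1, by omega⟩
            · simp [hb]
            · simp
          omega
        · obtain ⟨N, h1, h2⟩ := ih (j - (L + 2)) (by omega) (r + L + 2) (by omega)
          refine ⟨N + 1, ?_, ?_⟩
          · calc M r ≤ q * M (r + L + 2) := hgood r h hb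
              _ ≤ q * (q ^ N * K) := mul_le_mul_of_nonneg_left h1 hq
              _ = q ^ (N + 1) * K := by ring
          · have : (bad.filter (r + L + 2 ≤ ·)).card ≤ (bad.filter (r ≤ ·)).card := by
              refine Finset.card_le_card fun a ha => ?_
              rw [Finset.mem_filter] at ha ⊢
              exact ⟨ha.1, by omega⟩
            rw [Nat.add_mul]
            omega
      · exact ⟨0, by simpa using hK r, by omega⟩
  obtain ⟨N, h1, h2⟩ := key D 0 (by simp)
  exact ⟨N, h1, by simpa using h2⟩

end Iteration

/-! ### Decay of the Green function with few singular balls -/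

section Decay

open Classical

variable {Z : Type*} {𝒵 : SimpleGraph Z} {V : Z → ℝ} {E ε C d m : ℝ} {Λ : Finset Z} {L n : ℕ}

/-- The ball of radius `r` about `x` relative to the finite set `Λ`, as a finite set. -/
noncomputable def finBall (𝒵 : SimpleGraph Z) (Λ : Finset Z) (x : Z) (r : ℕ) : Finset Z :=
  Λ.filter fun y => relDist 𝒵 (Λ : Set Z) x y ≤ r

lemma mem_finBall {x y : Z} {r : ℕ} :
    y ∈ finBall 𝒵 Λ x r ↔ y ∈ Λ ∧ relDist 𝒵 (Λ : Set Z) x y ≤ r := Finset.mem_filter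

lemma finBall_subset (x : Z) (r : ℕ) : finBall 𝒵 Λ x r ⊆ Λ := Finset.filter_subset _ _

lemma coe_finBall (x : Z) (r : ℕ) :
    (finBall 𝒵 Λ x r : Set Z) = relBall 𝒵 (Λ : Set Z) x r := by
  ext y
  simp [mem_finBall, relBall]

/-- If at most `n - 1` of the balls with a property can be pairwise disjoint, then the centres of
all balls with that property lie on few spheres about any given point. -/
lemma card_radii_le (hconn : (𝒵.induce (Λ : Set Z)).Connected) {x : Z} (hx : x ∈ Λ)
    (P : Z → Prop)
    (h : ∀ s ⊆ Λ, s.card = n → (s : Set Z).PairwiseDisjoint (fun c => finBall 𝒵 Λ c L) →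
      ∃ c ∈ s, ¬ P c) (D : ℕ) :
    ((Finset.range D).filter fun r => ∃ w ∈ Λ, relDist 𝒵 (Λ : Set Z) x w = r + 1 ∧ P w).card ≤
      n * (4 * L + 2) := by
  set F : Finset (Finset Z) := Λ.powerset.filter fun s =>
    (∀ c ∈ s, P c) ∧ (s : Set Z).PairwiseDisjoint (fun c => finBall 𝒵 Λ c L) with hF
  have hne : F.Nonempty := ⟨∅, by simp [hF]⟩
  obtain ⟨s, hs, hmax⟩ := Finset.exists_max_image F Finset.card hne
  rw [hF, Finset.mem_filter, Finset.mem_powerset] at hs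
  obtain ⟨hsΛ, hsP, hsd⟩ := hs
  have hcard : s.card ≤ n := by
    by_contra! hlt
    obtain ⟨t, hts, htn⟩ := Finset.exists_subset_card_eq hlt.le
    obtain ⟨c, hc, hPc⟩ := h t (hts.trans hsΛ) htn (hsd.subset (by exact_mod_cast hts))
    exact hPc (hsP c (hts hc))
  -- The radius `r` stands for the sphere of radius `r + 1`, hence the extra `1` at the lower end.
  have hsub : ((Finset.range D).filter fun r =>
      ∃ w ∈ Λ, relDist 𝒵 (Λ : Set Z) x w = r + 1 ∧ P w) ⊆
      s.biUnion fun c => Finset.Icc (relDist 𝒵 (Λ : Set Z) x c - (2 * L + 1))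
        (relDist 𝒵 (Λ : Set Z) x c + 2 * L) := by
    intro r hr
    obtain ⟨-, w, hw, hxw, hPw⟩ := Finset.mem_filter.1 hr
    -- By maximality of `s`, the ball about `w` meets the ball about some member of `s`.
    have hclose : ∃ c ∈ s, relDist 𝒵 (Λ : Set Z) w c ≤ 2 * L := by
      by_cases hws : w ∈ s
      · exact ⟨w, hws, by simp [relDist_self]⟩
      · by_contra! hfar
        have hins : insert w s ∈ F := by
          rw [hF, Finset.mem_filter, Finset.mem_powerset]
          refine ⟨Finset.insert_subset hw hsΛ, ?_, ?_⟩
          · simpa using ⟨hPw, hsP⟩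
          · rw [Finset.coe_insert]
            refine hsd.insert fun c hc _ => Finset.disjoint_left.2 fun z hz hz' => ?_
            rw [mem_finBall] at hz hz'
            have h1 := hfar c hc
            have h2 := relDist_triangle hconn (z := c) (Finset.mem_coe.2 hw)
              (Finset.mem_coe.2 hz.1)
            rw [relDist_comm z c] at h2
            omega
        have := hmax _ hins
        rw [Finset.card_insert_of_notMem hws] at this
        omega
    obtain ⟨c, hc, hwc⟩ := hclose
    have hcΛ := hsΛ hc
    refine Finset.mem_biUnion.2 ⟨c, hc, Finset.mem_Icc.2 ?_⟩
    have h1 := relDist_triangle hconn (z := c) (Finset.mem_coe.2 hx) (Finset.mem_coe.2 hw)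
    have h2 := relDist_triangle hconn (z := w) (Finset.mem_coe.2 hx) (Finset.mem_coe.2 hcΛ)
    rw [relDist_comm c w] at h2
    omega
  calc _ ≤ _ := Finset.card_le_card hsub
    _ ≤ s.card * (4 * L + 2) := Finset.card_biUnion_le_card_mul _ _ _ fun c _ => by
        rw [Nat.card_Icc]; omega
    _ ≤ n * (4 * L + 2) := Nat.mul_le_mul_right _ hcard

/-- Decay of the Green function in a nonresonant set in which only few disjoint balls are
singular. -/
lemma exists_greenFunction_decay (hgr : PolynomialGrowth 𝒵 C d) (hC : 0 < C) (hL : 1 ≤ L)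
    (hε : 0 < ε) (hconn : (𝒵.induce (Λ : Set Z)).Connected) (x y : Λ) {D : ℕ}
    (hD : D ≤ relDist 𝒵 (Λ : Set Z) x y) (hΛ : IsNonresonant 𝒵 V E ε Λ)
    (hball : ∀ r < D, IsNonresonant 𝒵 V E ε (finBall 𝒵 Λ x r))
    (hsing : ∀ s ⊆ Λ, s.card = n → (s : Set Z).PairwiseDisjoint (fun c => finBall 𝒵 Λ c L) →
      ∃ c ∈ s, IsNonsingular 𝒵 C d V E m (Λ : Set Z) L (finBall 𝒵 Λ c L)) :
    ∃ N : ℕ, |greenFunction 𝒵 V Λ E x y| ≤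
        (C / ε * Real.exp (-(γ m L * L))) ^ N * (1 / ε) ∧
      D ≤ N * (L + 2) + n * (4 * L + 2) + L + 1 := by
  have hE := hΛ.notMem_spectrum hε
  set f := greenColumn 𝒵 V E Λ y with hf
  have hx : ∀ r, (x : Z) ∈ finBall 𝒵 Λ x r := fun r =>
    mem_finBall.2 ⟨x.2, by simp [relDist_self]⟩
  set M : ℕ → ℝ := fun r => (finBall 𝒵 Λ x r).sup' ⟨x, hx r⟩ fun z => |f z| with hM
  have hle : ∀ {r z}, z ∈ finBall 𝒵 Λ x r → |f z| ≤ M r := fun {r z} hz =>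
    Finset.le_sup' (fun z => |f z|) hz
  have hM0 : ∀ r, 0 ≤ M r := fun r => (abs_nonneg _).trans (hle (hx r))
  have hmono : Monotone M := fun r r' hr => Finset.sup'_le _ _ fun z hz =>
    hle (mem_finBall.2 ⟨(mem_finBall.1 hz).1, (mem_finBall.1 hz).2.trans hr⟩)
  have hMK : ∀ r, M r ≤ 1 / ε := fun r =>
    Finset.sup'_le _ _ fun z _ => hΛ.abs_greenColumn_le hε y z
  obtain ⟨P, hP⟩ : ∃ P : Z → Prop, ∀ w,
      P w ↔ ¬ IsNonsingular 𝒵 C d V E m (Λ : Set Z) L (finBall 𝒵 Λ w L) := ⟨_, fun _ => Iff.rfl⟩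
  obtain ⟨bad, hbad⟩ : ∃ bad, bad = (Finset.range D).filter fun r =>
    ∃ w ∈ Λ, relDist 𝒵 (Λ : Set Z) x w = r + 1 ∧ P w := ⟨_, rfl⟩
  have hbadcard : bad.card ≤ n * (4 * L + 2) := by
    rw [hbad]
    refine card_radii_le hconn x.2 P (fun s h1 h2 h3 => ?_) D
    obtain ⟨c, hc, hcn⟩ := hsing s h1 h2 h3
    exact ⟨c, hc, fun h => (hP c).1 h hcn⟩
  -- The `L`-balls are centred at radius `r + 1` and their outer spheres lie `L + 1` further out,
  -- hence `r + L + 2`. The condition `r + L + 1 < D` keeps `y` out of these balls, so that `f`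
  -- solves the equation there.
  have hgood : ∀ r, r + L + 1 < D → r ∉ bad →
      M r ≤ (C / ε * Real.exp (-(γ m L * L))) * M (r + L + 2) := by
    intro r hr hrb
    have hns : ∀ w ∈ Λ, relDist 𝒵 (Λ : Set Z) x w = r + 1 →
        IsNonsingular 𝒵 C d V E m (Λ : Set Z) L (finBall 𝒵 Λ w L) := by
      intro w hw hxw
      by_contra hcon
      refine hrb ?_
      rw [hbad]
      exact Finset.mem_filter.2 ⟨Finset.mem_range.2 (by omega), w, hw, hxw, (hP w).2 hcon⟩
    have hsphere : ∀ w ∈ Λ, relDist 𝒵 (Λ : Set Z) x w = r + 1 →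
        |f w| ≤ Real.exp (-(γ m L * L)) * M (r + L + 2) := by
      intro w hw hxw
      refine (hns w hw hxw).abs_le_of_sphere hgr hC hL (hM0 _) hconn hw (coe_finBall w L)
        (fun z hz => ?_) (fun v hv hwv => ?_)
      · rw [mem_finBall] at hz
        refine schrodingerApply_greenColumn hE y hz.1 fun hzy => ?_
        have := relDist_triangle hconn (z := z) (Finset.mem_coe.2 x.2) (Finset.mem_coe.2 hw)
        rw [hzy] at this hz
        omega
      · refine hle (mem_finBall.2 ⟨hv, ?_⟩)
        have := relDist_triangle hconn (z := v) (Finset.mem_coe.2 x.2) (Finset.mem_coe.2 hw)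
        omega
    refine Finset.sup'_le _ _ fun z hz => ?_
    rw [mul_assoc]
    refine (hball r (by omega)).abs_le_of_boundary hgr hC.le
      (mul_nonneg (Real.exp_pos _).le (hM0 _)) hε (finBall_subset _ _) (fun w hw => ?_)
      (fun w hw v hv hadj => ?_) hz
    · rw [mem_finBall] at hw
      refine schrodingerApply_greenColumn hE y hw.1 fun hwy => ?_
      rw [hwy] at hw
      omega
    · rw [mem_finBall] at hw
      rw [Finset.mem_sdiff, mem_finBall] at hv
      refine hsphere v hv.1 (le_antisymm ?_ ?_)
      · exact (relDist_adj_le hconn (Finset.mem_coe.2 x.2) (Finset.mem_coe.2 hw.1)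
          (Finset.mem_coe.2 hv.1) hadj).trans (by omega)
      · by_contra hlt
        exact hv.2 ⟨hv.1, by omega⟩
  obtain ⟨N, h1, h2⟩ := exists_iterate_bound (by positivity) hmono hMK hgood
  refine ⟨N, ?_, by omega⟩
  rw [← greenColumn_coe]
  exact (hle (hx 0)).trans h1

end Decay

/-! ### Wegner estimate in the sup norm -/

section Wegner

/-- A probability measure with Lipschitz distribution function gives small mass to sets of small
diameter. -/
lemma measure_le_of_cdf_lipschitz {ν : Measure ℝ} [IsProbabilityMeasure ν] {c r : ℝ}
    (hν : ∀ t s : ℝ, 0 ≤ s → cdf ν (t + s) - cdf ν t ≤ c * s) (hr : 0 ≤ r) {A : Set ℝ}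
    (hA : ∀ s ∈ A, ∀ t ∈ A, |t - s| ≤ r) : ν A ≤ ENNReal.ofReal (c * r) := by
  rcases A.eq_empty_or_nonempty with rfl | ⟨a₀, ha₀⟩
  · simp
  have hbdd : BddBelow A := ⟨a₀ - r, fun t ht => by
    have := abs_le.1 (hA a₀ ha₀ t ht); linarith⟩
  set a := sInf A with ha
  -- `Ioc` omits its left endpoint while `A` may contain its infimum; the shift `η` is sent to `0`
  -- afterwards.
  have hsub : ∀ η > 0, A ⊆ Set.Ioc (a - η) (a - η + (r + η)) := by
    intro η hη t ht
    have h1 : a ≤ t := csInf_le hbdd ht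
    refine ⟨by linarith, ?_⟩
    have h2 : t - r ≤ a := le_csInf ⟨a₀, ha₀⟩ fun s hs => by
      have := abs_le.1 (hA s hs t ht); linarith
    linarith
  have hbound : ∀ η > 0, ν A ≤ ENNReal.ofReal (c * (r + η)) := by
    intro η hη
    refine (measure_mono (hsub η hη)).trans ?_
    rw [← measure_cdf ν, StieltjesFunction.measure_Ioc]
    exact ENNReal.ofReal_le_ofReal (hν _ _ (by linarith))
  have hlim : Filter.Tendsto (fun η : ℝ => ENNReal.ofReal (c * (r + η)))
      (nhdsWithin 0 (Set.Ioi 0)) (nhds (ENNReal.ofReal (c * r))) := by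
    have : Continuous fun η : ℝ => ENNReal.ofReal (c * (r + η)) :=
      ENNReal.continuous_ofReal.comp (by fun_prop)
    have h := (this.tendsto 0).mono_left (nhdsWithin_le_nhds (s := Set.Ioi 0))
    simpa using h
  refine ge_of_tendsto hlim ?_
  filter_upwards [self_mem_nhdsWithin] with η hη using hbound η hη

/-- If `X` is independent of `Y` and all sections of a measurable set have small mass under the law
of `X`, then `(Y, X)` is unlikely to lie in the set. -/
lemma IndepFun.measure_preimage_prod_le {Ω β : Type*} [MeasurableSpace Ω] [MeasurableSpace β]
    {μ : Measure Ω} [IsProbabilityMeasure μ] {Y : Ω → β} {X : Ω → ℝ} (h : IndepFun Y X μ)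
    (hY : Measurable Y) (hX : Measurable X) {S : Set (β × ℝ)} (hS : MeasurableSet S)
    {c : ENNReal} (hc : ∀ b, (μ.map X) {t | (b, t) ∈ S} ≤ c) :
    μ {ω | (Y ω, X ω) ∈ S} ≤ c := by
  have := Measure.isProbabilityMeasure_map (μ := μ) hY.aemeasurable
  have := Measure.isProbabilityMeasure_map (μ := μ) hX.aemeasurable
  calc μ {ω | (Y ω, X ω) ∈ S} = (μ.map fun ω => (Y ω, X ω)) S :=
        (Measure.map_apply (hY.prodMk hX) hS).symm
    _ = ((μ.map Y).prod (μ.map X)) S := by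
        rw [(indepFun_iff_map_prod_eq_prod_map_map hY.aemeasurable hX.aemeasurable).1 h]
    _ = ∫⁻ b, (μ.map X) (Prod.mk b ⁻¹' S) ∂(μ.map Y) := Measure.prod_apply hS
    _ ≤ ∫⁻ _, c ∂(μ.map Y) := lintegral_mono fun b => hc b
    _ = c := by simp

open Classical Matrix

variable {Z : Type*} {𝒵 : SimpleGraph Z} {V V' : Z → ℝ} {E ε : ℝ} {Λ : Finset Z}

/-- The extension by zero of a potential on `Λ`. -/
noncomputable def extendPotential (Λ : Finset Z) (v : Λ → ℝ) (z : Z) : ℝ :=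
  if h : z ∈ Λ then v ⟨z, h⟩ else 0

lemma extendPotential_coe (v : Λ → ℝ) (z : Λ) : extendPotential Λ v z = v z := by
  simp [extendPotential]

lemma hamiltonian_congr (h : ∀ z ∈ Λ, V z = V' z) :
    hamiltonian 𝒵 V Λ = hamiltonian 𝒵 V' Λ := by
  ext x y
  simp [hamiltonian, h x x.2]

lemma hamiltonian_extendPotential (V : Z → ℝ) :
    hamiltonian 𝒵 (extendPotential Λ fun z => V z) Λ = hamiltonian 𝒵 V Λ :=
  hamiltonian_congr fun z hz => by simp [extendPotential, hz]

lemma continuous_hamiltonian :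
    Continuous fun v : Λ → ℝ => hamiltonian 𝒵 (extendPotential Λ v) Λ := by
  refine continuous_matrix fun x y => ?_
  simp only [hamiltonian, Matrix.of_apply, extendPotential_coe]
  split_ifs <;> fun_prop

lemma hamiltonian_transpose : (hamiltonian 𝒵 V Λ)ᵀ = hamiltonian 𝒵 V Λ := by
  ext x y
  simp only [Matrix.transpose_apply, hamiltonian, Matrix.of_apply, 𝒵.adj_comm y x, eq_comm (a := y)]
  by_cases h : x = y
  · subst h; rfl
  · simp [h]

lemma hamiltonian_eq_add_diagonal :
    hamiltonian 𝒵 V Λ =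
      hamiltonian 𝒵 V' Λ + Matrix.diagonal fun z : Λ => V z - V' z := by
  ext x y
  by_cases h : x = y
  · subst h; simp [hamiltonian]
  · simp [hamiltonian, h]

lemma abs_dotProduct_le {ι : Type*} [Fintype ι] {φ η : ι → ℝ} {e : ℝ} (hφ : ‖φ‖ ≤ 1)
    (hη : ‖η‖ ≤ e) : |φ ⬝ᵥ η| ≤ Fintype.card ι * e := by
  calc |φ ⬝ᵥ η| ≤ ∑ i, |φ i * η i| := Finset.abs_sum_le_sum_abs _ _
    _ ≤ ∑ _i : ι, e := Finset.sum_le_sum fun i _ => by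
        rw [abs_mul]
        have h1 : |φ i| ≤ 1 := (norm_le_pi_norm φ i).trans hφ
        have h2 : |η i| ≤ e := (norm_le_pi_norm η i).trans hη
        calc |φ i| * |η i| ≤ 1 * e := mul_le_mul h1 h2 (abs_nonneg _) zero_le_one
          _ = e := one_mul e
    _ = Fintype.card ι * e := by simp

/-- Two potentials that agree off one site, and for which `E` is almost an eigenvalue with an
approximate eigenvector that is maximal at this site, are close at this site. -/
lemma abs_potential_sub_le {x : Λ} (hV : ∀ z : Λ, z ≠ x → V z = V' z) {ψ φ : Λ → ℝ}
    (hψ : ‖ψ‖ ≤ 1) (hφ : ‖φ‖ ≤ 1) (hψx : |ψ x| = 1) (hφx : |φ x| = 1)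
    (h : ‖(hamiltonian 𝒵 V Λ - E • (1 : Matrix Λ Λ ℝ)) *ᵥ ψ‖ ≤ ε)
    (h' : ‖(hamiltonian 𝒵 V' Λ - E • (1 : Matrix Λ Λ ℝ)) *ᵥ φ‖ ≤ ε) :
    |V x - V' x| ≤ 2 * Λ.card * ε := by
  set A := hamiltonian 𝒵 V Λ - E • (1 : Matrix Λ Λ ℝ) with hA
  set A' := hamiltonian 𝒵 V' Λ - E • (1 : Matrix Λ Λ ℝ) with hA'
  have hsum : A = A' + Matrix.diagonal fun z : Λ => V z - V' z := by
    rw [hA, hA', hamiltonian_eq_add_diagonal (V := V) (V' := V')]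
    abel
  have hsymm : A'ᵀ = A' := by
    rw [hA', Matrix.transpose_sub, hamiltonian_transpose, Matrix.transpose_smul,
      Matrix.transpose_one]
  -- By symmetry the two forms differ only through the diagonal entry at `x`, where both vectors
  -- have modulus `1`.
  have h1 : φ ⬝ᵥ (A *ᵥ ψ) = ψ ⬝ᵥ (A' *ᵥ φ) + (V x - V' x) * (φ x * ψ x) := by
    rw [hsum, Matrix.add_mulVec, dotProduct_add]
    congr 1
    · rw [Matrix.dotProduct_mulVec, ← Matrix.mulVec_transpose, hsymm, dotProduct_comm]
    · rw [dotProduct, Finset.sum_eq_single x]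
      · rw [Matrix.mulVec_diagonal]; ring
      · intro z _ hz
        rw [Matrix.mulVec_diagonal, hV z hz]; ring
      · simp
  have h2 : |V x - V' x| = |φ ⬝ᵥ (A *ᵥ ψ) - ψ ⬝ᵥ (A' *ᵥ φ)| := by
    rw [h1, add_sub_cancel_left, abs_mul, abs_mul, hφx, hψx]
    ring
  rw [h2]
  have h3 := abs_dotProduct_le hφ h
  have h4 := abs_dotProduct_le hψ h'
  rw [Fintype.card_coe] at h3 h4
  have := abs_sub (φ ⬝ᵥ (A *ᵥ ψ)) (ψ ⬝ᵥ (A' *ᵥ φ))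
  linarith

/-- The potentials on `Λ` for which some approximate eigenvector is maximal at `x`. -/
def resonantAt (𝒵 : SimpleGraph Z) (E ε : ℝ) (Λ : Finset Z) (x : Λ) : Set (Λ → ℝ) :=
  {v | ∃ ψ : Λ → ℝ, ‖ψ‖ ≤ 1 ∧ |ψ x| = 1 ∧
    ‖(hamiltonian 𝒵 (extendPotential Λ v) Λ - E • (1 : Matrix Λ Λ ℝ)) *ᵥ ψ‖ ≤ ε}

/-- This set is the projection of a closed set along the compact unit ball of vectors `ψ`.
Closedness provides the measurability needed for Fubini. -/
lemma isClosed_resonantAt (x : Λ) : IsClosed (resonantAt 𝒵 E ε Λ x) := by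
  have hcomp : CompactSpace (Metric.closedBall (0 : Λ → ℝ) 1) :=
    isCompact_iff_compactSpace.1 (isCompact_closedBall 0 1)
  have hH := continuous_hamiltonian (𝒵 := 𝒵) (Λ := Λ)
  have hcl : IsClosed {p : Metric.closedBall (0 : Λ → ℝ) 1 × (Λ → ℝ) |
      |(p.1 : Λ → ℝ) x| = 1 ∧ ‖(hamiltonian 𝒵 (extendPotential Λ p.2) Λ -
        E • (1 : Matrix Λ Λ ℝ)) *ᵥ (p.1 : Λ → ℝ)‖ ≤ ε} := by
    rw [Set.ofPred_and]
    refine IsClosed.inter (isClosed_eq ?_ continuous_const) (isClosed_le ?_ continuous_const)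
    · have : Continuous fun p : Metric.closedBall (0 : Λ → ℝ) 1 × (Λ → ℝ) => (p.1 : Λ → ℝ) x :=
        (continuous_apply x).comp (continuous_subtype_val.comp continuous_fst)
      exact this.abs
    · exact (Continuous.matrix_mulVec ((hH.comp continuous_snd).sub continuous_const)
        (continuous_subtype_val.comp continuous_fst)).norm
  have himg := isClosedMap_snd_of_compactSpace _ hcl
  convert himg using 1
  ext v
  simp [resonantAt, and_left_comm]

lemma exists_mem_resonantAt (h : ¬ IsNonresonant 𝒵 V E ε Λ) :
    ∃ x : Λ, (fun z : Λ => V z) ∈ resonantAt 𝒵 E ε Λ x := by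
  simp only [IsNonresonant, not_forall, not_le] at h
  obtain ⟨ψ, hψ⟩ := h
  have hψ0 : ψ ≠ 0 := by
    rintro rfl
    simp at hψ
  have hpos : 0 < ‖ψ‖ := norm_pos_iff.2 hψ0
  obtain ⟨z, hz⟩ : ∃ z, ψ z ≠ 0 := by
    by_contra! hcon
    exact hψ0 (funext hcon)
  have : Nonempty Λ := ⟨z⟩
  obtain ⟨x, hx⟩ := Finite.exists_max fun z => ‖ψ z‖
  have hnorm : ‖ψ x‖ = ‖ψ‖ :=
    le_antisymm (norm_le_pi_norm ψ x) ((pi_norm_le_iff_of_nonneg (norm_nonneg _)).2 hx)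
  refine ⟨x, ‖ψ‖⁻¹ • ψ, ?_, ?_, ?_⟩
  · rw [norm_smul, norm_inv, norm_norm, inv_mul_cancel₀ hpos.ne']
  · rw [Pi.smul_apply, smul_eq_mul, abs_mul, abs_inv, abs_norm, ← Real.norm_eq_abs (ψ x), hnorm,
      inv_mul_cancel₀ hpos.ne']
  · rw [hamiltonian_extendPotential, Matrix.mulVec_smul, norm_smul, norm_inv, norm_norm,
      inv_mul_le_iff₀ hpos, mul_comm]
    exact hψ.le

variable {Ω : Type*} [MeasurableSpace Ω] {μ : Measure Ω} [IsProbabilityMeasure μ]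
  {V : Z → Ω → ℝ} {C_W : ℝ}

lemma IsIIDPotential.measure_resonantAt_le (hV : IsIIDPotential μ V C_W)
    (hε : 0 ≤ ε) (x : Λ) :
    μ {ω | (fun z : Λ => V z ω) ∈ resonantAt 𝒵 E ε Λ x} ≤
      ENNReal.ofReal (C_W * (2 * Λ.card * ε)) := by
  -- The value at `x` is glued to the configuration off `x`, so that sections fix all other sites
  -- and `abs_potential_sub_le` bounds their diameter.
  let comb : (↥(Λ.erase (x : Z)) → ℝ) × ℝ → Λ → ℝ := fun p z =>
    if h : z = x then p.2 else p.1 ⟨z, Finset.mem_erase.2 ⟨fun h' => h (Subtype.ext h'), z.2⟩⟩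
  have hcomb : Measurable comb := by
    refine measurable_pi_lambda _ fun z => ?_
    by_cases h : z = x
    · simp only [comb, h, dite_true]; exact measurable_snd
    · simp only [comb, h, dite_false]; exact (measurable_pi_apply _).comp measurable_fst
  have hind : IndepFun (fun ω (z : ↥(Λ.erase (x : Z))) => V z ω) (V x) μ := by
    have h := hV.indep.indepFun_finset (Λ.erase x) {(x : Z)} (by simp) hV.measurable
    exact h.comp measurable_id (measurable_pi_apply (⟨x, by simp⟩ : ({(x : Z)} : Finset Z)))
  have hY : Measurable fun ω (z : ↥(Λ.erase (x : Z))) => V z ω :=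
    measurable_pi_lambda _ fun z => hV.measurable z
  have hS : MeasurableSet (comb ⁻¹' resonantAt 𝒵 E ε Λ x) :=
    hcomb (isClosed_resonantAt x).measurableSet
  have := Measure.isProbabilityMeasure_map (μ := μ) (hV.measurable x).aemeasurable
  refine le_trans (le_of_eq ?_)
    (IndepFun.measure_preimage_prod_le hind hY (hV.measurable x) hS fun b => ?_)
  · congr 1
    ext ω
    have : (fun z : Λ => V z ω) =
        comb (fun z : ↥(Λ.erase (x : Z)) => V z ω, V x ω) := by
      ext z
      by_cases h : z = x
      · simp [comb, h]
      · simp [comb, h]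
    simp only [Set.mem_ofPred_eq, Set.mem_preimage, this]
  · refine measure_le_of_cdf_lipschitz (hV.lipschitz x) (by positivity) ?_
    rintro s ⟨φ, hφ, hφx, hφε⟩ t ⟨ψ, hψ, hψx, hψε⟩
    have := abs_potential_sub_le (fun z hz => ?_) hψ hφ hψx hφx hψε hφε
    · simpa [extendPotential_coe, comb] using this
    · simp [extendPotential_coe, comb, hz]

/-- Wegner estimate. -/
lemma IsIIDPotential.measure_not_isNonresonant_le (hV : IsIIDPotential μ V C_W) (hC : 0 ≤ C_W)
    (hε : 0 ≤ ε) (Λ : Finset Z) :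
    μ.real {ω | ¬ IsNonresonant 𝒵 (fun z => V z ω) E ε Λ} ≤
      Λ.card * (C_W * (2 * Λ.card * ε)) := by
  refine ENNReal.toReal_le_of_le_ofReal (by positivity) ?_
  calc μ {ω | ¬ IsNonresonant 𝒵 (fun z => V z ω) E ε Λ}
      ≤ μ (⋃ x ∈ (Finset.univ : Finset Λ),
          {ω | (fun z : Λ => V z ω) ∈ resonantAt 𝒵 E ε Λ x}) := by
        refine measure_mono fun ω hω => ?_
        simpa using exists_mem_resonantAt hω
    _ ≤ ∑ x ∈ (Finset.univ : Finset Λ),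
          μ {ω | (fun z : Λ => V z ω) ∈ resonantAt 𝒵 E ε Λ x} := measure_biUnion_finset_le _ _
    _ ≤ ∑ _x ∈ (Finset.univ : Finset Λ), ENNReal.ofReal (C_W * (2 * Λ.card * ε)) :=
        Finset.sum_le_sum fun x _ => hV.measure_resonantAt_le hε x
    _ = ENNReal.ofReal (Λ.card * (C_W * (2 * Λ.card * ε))) := by
        rw [Finset.sum_const, Finset.card_univ, Fintype.card_coe,
          ENNReal.ofReal_mul (Nat.cast_nonneg _), ENNReal.ofReal_natCast, nsmul_eq_mul]

end Wegner

/-! ### Independence of disjoint balls -/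

section Independence

open Classical Matrix

variable {Z : Type*} {𝒵 : SimpleGraph Z} {E C d m : ℝ} {L : ℕ}

lemma isNonsingular_congr {V V' : Z → ℝ} {G : Set Z} {Λ : Finset Z} (h : ∀ z ∈ Λ, V z = V' z) :
    IsNonsingular 𝒵 C d V E m G L Λ ↔ IsNonsingular 𝒵 C d V' E m G L Λ := by
  simp only [IsNonsingular, greenFunction, hamiltonian_congr (𝒵 := 𝒵) h]

/-- By Cramer's rule each entry is a polynomial in the potential times the inverse of the
determinant, and inversion is measurable also at `0`. -/
lemma measurable_greenFunction {Λ : Finset Z} (x y : Λ) :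
    Measurable fun v : Λ → ℝ => greenFunction 𝒵 (extendPotential Λ v) Λ E x y := by
  have hH : Continuous fun v : Λ → ℝ =>
      hamiltonian 𝒵 (extendPotential Λ v) Λ - E • (1 : Matrix Λ Λ ℝ) :=
    continuous_hamiltonian.sub continuous_const
  simp only [greenFunction, Matrix.inv_def, Ring.inverse_eq_inv', Matrix.smul_apply, smul_eq_mul]
  exact hH.matrix_det.measurable.inv.mul (hH.matrix_adjugate.matrix_elem x y).measurable

lemma measurableSet_isNonsingular (G : Set Z) (Λ : Finset Z) :
    MeasurableSet {v : Λ → ℝ | IsNonsingular 𝒵 C d (extendPotential Λ v) E m G L Λ} := by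
  have hH : Continuous fun v : Λ → ℝ =>
      hamiltonian 𝒵 (extendPotential Λ v) Λ - E • (1 : Matrix Λ Λ ℝ) :=
    continuous_hamiltonian.sub continuous_const
  simp only [IsNonsingular, notMem_spectrum_iff_isUnit_det, isUnit_iff_ne_zero]
  rw [Set.ofPred_and]
  refine MeasurableSet.inter
    (hH.matrix_det.measurable (measurableSet_singleton 0).compl) ?_
  refine MeasurableSet.congr (MeasurableSet.iInter fun x : Λ => MeasurableSet.iInter fun y : Λ =>
    MeasurableSet.iInter fun _ : (L : ℝ) ^ ((1 + ϱ) / α) ≤ (relDist 𝒵 G x y : ℝ) =>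
      measurableSet_le ((measurable_greenFunction (𝒵 := 𝒵) (E := E) x y).norm.const_mul
        (C ^ 2 * (L : ℝ) ^ d)) (measurable_const
          (a := Real.exp (-(γ m L * (relDist 𝒵 G x y : ℝ)))))) ?_
  ext v
  simp

variable {Ω : Type*} [MeasurableSpace Ω] {μ : Measure Ω} [IsProbabilityMeasure μ]
  {V : Z → Ω → ℝ} {C_W : ℝ}

/-- Events that depend on the potential in pairwise disjoint finite sets have a joint probability
at most the product of their individual bounds. -/
lemma IsIIDPotential.measureReal_forall_le_pow (hV : IsIIDPotential μ V C_W) {ι : Type*}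
    (s : Finset ι) (S : ι → Finset Z) (hS : (s : Set ι).PairwiseDisjoint S)
    (T : ∀ i, Set (S i → ℝ)) (hT : ∀ i ∈ s, MeasurableSet (T i)) {p : ℝ} (hp : 0 ≤ p)
    (h : ∀ i ∈ s, μ.real {ω | (fun z : S i => V z ω) ∈ T i} ≤ p) :
    μ.real {ω | ∀ i ∈ s, (fun z : S i => V z ω) ∈ T i} ≤ p ^ s.card := by
  induction s using Finset.induction_on with
  | empty => simp
  | insert a s ha ih =>
    have ih' := ih (hS.subset (by simp)) (fun i hi => hT i (Finset.mem_insert_of_mem hi))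
      (fun i hi => h i (Finset.mem_insert_of_mem hi))
    have hdisj : Disjoint (S a) (s.biUnion S) := by
      rw [Finset.disjoint_biUnion_right]
      intro i hi
      exact hS (by simp) (by simp [hi]) (fun h => ha (h ▸ hi))
    have hind := hV.indep.indepFun_finset _ _ hdisj hV.measurable
    set T' : Set (↥(s.biUnion S) → ℝ) :=
      {v | ∀ i (hi : i ∈ s), (fun z : S i => v ⟨z, Finset.mem_biUnion.2 ⟨i, hi, z.2⟩⟩) ∈ T i}
      with hT'
    have hT'm : MeasurableSet T' := by
      have : T' = ⋂ i : s, {v : ↥(s.biUnion S) → ℝ |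
          (fun z : S i => v ⟨z, Finset.mem_biUnion.2 ⟨i, i.2, z.2⟩⟩) ∈ T i} := by
        ext v; simp [hT']
      rw [this]
      refine MeasurableSet.iInter fun i => ?_
      have hm : Measurable fun (v : ↥(s.biUnion S) → ℝ) (z : S i) =>
          v ⟨z, Finset.mem_biUnion.2 ⟨i, i.2, z.2⟩⟩ :=
        measurable_pi_lambda _ fun z => measurable_pi_apply _
      exact hm (hT i (Finset.mem_insert_of_mem i.2))
    have hmul := hind.measure_inter_preimage_eq_mul _ _ (hT a (Finset.mem_insert_self a s)) hT'm
    have heq : {ω | ∀ i ∈ insert a s, (fun z : S i => V z ω) ∈ T i} =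
        ((fun ω (z : S a) => V z ω) ⁻¹' T a) ∩ ((fun ω (z : ↥(s.biUnion S)) => V z ω) ⁻¹' T') := by
      ext ω
      simp [hT']
    have heq' : {ω | ∀ i ∈ s, (fun z : S i => V z ω) ∈ T i} =
        (fun ω (z : ↥(s.biUnion S)) => V z ω) ⁻¹' T' := by
      ext ω
      simp [hT']
    rw [heq, measureReal_def, hmul, ENNReal.toReal_mul, Finset.card_insert_of_notMem ha, pow_succ']
    rw [heq'] at ih'
    exact mul_le_mul (h a (Finset.mem_insert_self a s)) ih' ENNReal.toReal_nonneg hp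

/-- Many disjoint singular balls are unlikely. -/
lemma IsIIDPotential.measureReal_exists_disjoint_singular_le (hV : IsIIDPotential μ V C_W)
    {Λ : Finset Z} {n : ℕ} {p : ℝ} (hp : 0 ≤ p)
    (h : ∀ c ∈ Λ, μ.real {ω | ¬ IsNonsingular 𝒵 C d (fun z => V z ω) E m (Λ : Set Z) L
      (finBall 𝒵 Λ c L)} ≤ p) :
    μ.real {ω | ∃ s ⊆ Λ, s.card = n ∧ (s : Set Z).PairwiseDisjoint (fun c => finBall 𝒵 Λ c L) ∧
      ∀ c ∈ s, ¬ IsNonsingular 𝒵 C d (fun z => V z ω) E m (Λ : Set Z) L (finBall 𝒵 Λ c L)} ≤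
      (Λ.card * p) ^ n := by
  set F := (Λ.powersetCard n).filter fun s : Finset Z =>
    (s : Set Z).PairwiseDisjoint (fun c => finBall 𝒵 Λ c L) with hF
  have hcard : (F.card : ℝ) ≤ (Λ.card : ℝ) ^ n := by
    have h1 : F.card ≤ Λ.card ^ n := (Finset.card_filter_le _ _).trans
      ((Finset.card_powersetCard _ _).trans_le (Nat.choose_le_pow _ _))
    exact_mod_cast h1
  calc _ ≤ μ.real (⋃ s ∈ F, {ω | ∀ c ∈ s,
        ¬ IsNonsingular 𝒵 C d (fun z => V z ω) E m (Λ : Set Z) L (finBall 𝒵 Λ c L)}) := by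
        refine measureReal_mono ?_ (measure_ne_top _ _)
        rintro ω ⟨s, hs, hsn, hsd, hsing⟩
        simp only [Set.mem_iUnion]
        exact ⟨s, Finset.mem_filter.2 ⟨Finset.mem_powersetCard.2 ⟨hs, hsn⟩, hsd⟩, hsing⟩
    _ ≤ ∑ s ∈ F, μ.real {ω | ∀ c ∈ s,
        ¬ IsNonsingular 𝒵 C d (fun z => V z ω) E m (Λ : Set Z) L (finBall 𝒵 Λ c L)} :=
        measureReal_biUnion_finset_le _ _
    _ ≤ ∑ s ∈ F, p ^ n := by
        refine Finset.sum_le_sum fun s hs => ?_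
        rw [hF, Finset.mem_filter, Finset.mem_powersetCard] at hs
        obtain ⟨⟨hsΛ, hsn⟩, hsd⟩ := hs
        have hiff : ∀ c ω, (¬ IsNonsingular 𝒵 C d (fun z => V z ω) E m (Λ : Set Z) L
            (finBall 𝒵 Λ c L)) ↔ (fun z : ↥(finBall 𝒵 Λ c L) => V z ω) ∈
              {v : ↥(finBall 𝒵 Λ c L) → ℝ | IsNonsingular 𝒵 C d
                (extendPotential (finBall 𝒵 Λ c L) v) E m (Λ : Set Z) L (finBall 𝒵 Λ c L)}ᶜ := by
          intro c ω
          refine not_congr (isNonsingular_congr fun z hz => ?_)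
          simp [extendPotential, hz]
        rw [← hsn]
        simp only [hiff] at h ⊢
        exact hV.measureReal_forall_le_pow s _ hsd _
          (fun c _ => (measurableSet_isNonsingular _ _).compl) hp (fun c hc => h c (hsΛ hc))
    _ = F.card * p ^ n := by simp
    _ ≤ (Λ.card : ℝ) ^ n * p ^ n := mul_le_mul_of_nonneg_right hcard (by positivity)
    _ = (Λ.card * p) ^ n := (mul_pow _ _ _).symm

end Independence

/-! ### Numerical estimates at large scales -/

section Scales

lemma pow_rpow_eq {t : ℝ} (ht : 0 ≤ t) (k : ℕ) (a b : ℝ) (h : k * a = b) :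
    (t ^ k) ^ a = t ^ b := by
  rw [← Real.rpow_natCast, ← Real.rpow_mul ht, h]

lemma le_scale {L₀ : ℕ} (h : 1 ≤ L₀) (k : ℕ) : L₀ ≤ scale L₀ k := by
  induction k with
  | zero => exact le_rfl
  | succ k ih =>
    refine ih.trans (Nat.le_floor ?_)
    have h1 : (1 : ℝ) ≤ scale L₀ k := by exact_mod_cast h.trans ih
    exact Real.self_le_rpow_of_one_le h1 (by norm_num [α])

/-- `t = L ^ (1 / 24)` is large in terms of the constants of the model. -/
structure IsLarge (d C C_W m₀ t : ℝ) : Prop where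
  large : 100 ≤ t
  mass : 10 ≤ m₀ * t
  volume : max C 1 ^ 2 * (t ^ 32) ^ max d 0 ≤ Real.exp t
  radii : 2 * t ^ 32 + 1 ≤ Real.exp t
  density : 2 * C_W ≤ Real.exp t

lemma eventually_isLarge (d C C_W : ℝ) {m₀ : ℝ} (hm₀ : 0 < m₀) :
    ∀ᶠ L : ℕ in Filter.atTop, IsLarge d C C_W m₀ ((L : ℝ) ^ (1 / 24 : ℝ)) := by
  have htend : Filter.Tendsto (fun L : ℕ => (L : ℝ) ^ (1 / 24 : ℝ)) Filter.atTop Filter.atTop :=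
    (tendsto_rpow_atTop (by norm_num)).comp tendsto_natCast_atTop_atTop
  refine htend.eventually (p := IsLarge d C C_W m₀) ?_
  have hvol : ∀ᶠ t : ℝ in Filter.atTop,
      max C 1 ^ 2 * (t ^ 32) ^ max d 0 ≤ Real.exp t := by
    have hlit := (isLittleO_rpow_exp_atTop (32 * max d 0)).def
      (c := (max C 1 ^ 2)⁻¹) (by positivity)
    filter_upwards [hlit, Filter.eventually_ge_atTop 0] with t ht ht0
    rw [pow_rpow_eq ht0 32 (max d 0) _ rfl]
    rw [Real.norm_eq_abs, Real.norm_eq_abs, Real.abs_exp, abs_of_nonneg (by positivity),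
      inv_mul_eq_div, le_div_iff₀ (by positivity)] at ht
    norm_num at ht ⊢
    linarith
  have hrad : ∀ᶠ t : ℝ in Filter.atTop, 2 * t ^ 32 + 1 ≤ Real.exp t := by
    have hlit := (Real.isLittleO_pow_exp_atTop (n := 32)).def (c := 1 / 3) (by norm_num)
    filter_upwards [hlit, Filter.eventually_ge_atTop 1] with t ht ht1
    rw [Real.norm_eq_abs, Real.norm_eq_abs, Real.abs_exp, abs_of_nonneg (by positivity)] at ht
    have := one_le_pow₀ ht1 (n := 32)
    linarith
  filter_upwards [hvol, hrad, Filter.eventually_ge_atTop 100, Filter.eventually_ge_atTop (10 / m₀),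
    Real.tendsto_exp_atTop.eventually_ge_atTop (2 * C_W)] with t h1 h2 h3 h4 h5
  exact ⟨h3, by rw [div_le_iff₀ hm₀] at h4; linarith, h1, h2, h5⟩

variable {d C C_W m₀ m t : ℝ}

/-- The exponent gained by iteration exceeds the one required at the next scale. -/
lemma exponent_le (ht : 100 ≤ t) (hmass : 10 ≤ m₀ * t) (hm₀ : 0 < m₀) (hm : m₀ ≤ m)
    {N n D : ℝ} (hN : 0 ≤ N) (hn : n ≤ 4 * t ^ 2 + 1) (hD : t ^ 32 / 2 ≤ D)
    (hDN : D ≤ N * (t ^ 24 + 2) + n * (4 * t ^ 24 + 2) + t ^ 24 + 1) :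
    t + N * (t + 2 * t ^ 8 - m * (1 + t⁻¹ ^ 3) * t ^ 24) + 2 * t ^ 8 ≤
      -(m * (1 + 2 * t⁻¹ ^ 4) * D) := by
  have ht0 : 0 < t := by linarith
  have ht1 : 1 ≤ t := by linarith
  have hm0 : 0 < m := hm₀.trans_le hm
  have hmt : 10 ≤ m * t := hmass.trans (mul_le_mul_of_nonneg_right hm ht0.le)
  set s := t⁻¹ with hs
  have hs0 : 0 < s := inv_pos.2 ht0
  have hts : t * s = 1 := mul_inv_cancel₀ ht0.ne'
  have hs1 : s ≤ 1 / 100 := by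
    rw [hs, inv_le_comm₀ ht0 (by norm_num)]; linarith
  have e24 : s ^ 3 * t ^ 24 = t ^ 21 := by
    calc s ^ 3 * t ^ 24 = (t * s) ^ 3 * t ^ 21 := by ring
      _ = t ^ 21 := by rw [hts]; ring
  have e26 : t ^ 26 = s ^ 6 * t ^ 32 := by
    calc t ^ 26 = (1 : ℝ) ^ 6 * t ^ 26 := by ring
      _ = s ^ 6 * t ^ 32 := by rw [← hts]; ring
  have e18 : s ^ 6 * t ^ 24 = t ^ 18 := by
    calc s ^ 6 * t ^ 24 = (t * s) ^ 6 * t ^ 18 := by ring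
      _ = t ^ 18 := by rw [hts]; ring
  have hsmall : t + 2 * t ^ 8 ≤ 3 * t ^ 8 := by
    have : t ≤ t ^ 8 := le_self_pow₀ ht1 (by norm_num)
    linarith
  have h8 : 3 * t ^ 8 ≤ m * t ^ 18 := by
    have h9 : t ^ 8 ≤ t ^ 17 := pow_le_pow_right₀ ht1 (by norm_num)
    have : m * t ^ 18 = (m * t) * t ^ 17 := by ring
    rw [this]
    have h17 : 0 ≤ t ^ 17 := by positivity
    nlinarith
  -- This absorbs the prefactors outside the iteration: the volume factor `exp t` and the a priori
  -- bound `exp (2 * t ^ 8)`.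
  have h8' : 3 * t ^ 8 ≤ m * (D * s ^ 6) := by
    have h1 : t ^ 26 / 2 ≤ D * s ^ 6 := by
      rw [e26]
      have := mul_le_mul_of_nonneg_right hD (pow_nonneg hs0.le 6)
      linarith
    have h2 : t ^ 18 ≤ t ^ 26 / 2 := by
      have : t ^ 26 = t ^ 18 * t ^ 8 := by ring
      rw [this]
      have h3 : 2 ≤ t ^ 8 := by
        calc (2 : ℝ) ≤ t := by linarith
          _ ≤ t ^ 8 := le_self_pow₀ ht1 (by norm_num)
      have h4 : 0 ≤ t ^ 18 := by positivity
      nlinarith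
    exact h8.trans (mul_le_mul_of_nonneg_left (h2.trans h1) hm0.le)
  -- Skipped radii and the last incomplete step use at most `26 * t ^ 26 = 26 * s ^ 6 * t ^ 32`, and
  -- `t ^ 32 ≤ 2 * D`.
  have hNlow : D * (1 - 52 * s ^ 6) ≤ N * (t ^ 24 + 2) := by
    have h1 : n * (4 * t ^ 24 + 2) + t ^ 24 + 1 ≤ 26 * t ^ 26 := by
      have h24 : 1 ≤ t ^ 24 := one_le_pow₀ ht1
      have h2 : 1 ≤ t ^ 2 := one_le_pow₀ ht1
      have h3 : n * (4 * t ^ 24 + 2) ≤ (4 * t ^ 2 + 1) * (4 * t ^ 24 + 2) :=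
        mul_le_mul_of_nonneg_right hn (by positivity)
      have h4 : (4 * t ^ 2 + 1) * (4 * t ^ 24 + 2) ≤
          (4 * t ^ 2 + t ^ 2 / 100) * (4 * t ^ 24 + 2 * t ^ 24) := by
        have : 100 ≤ t ^ 2 := ht.trans (le_self_pow₀ ht1 (by norm_num))
        exact mul_le_mul (by linarith) (by linarith) (by positivity) (by positivity)
      have h5 : t ^ 24 + 1 ≤ t ^ 26 := by
        have : t ^ 26 = t ^ 24 * t ^ 2 := by ring
        have h6 : 100 ≤ t ^ 2 := ht.trans (le_self_pow₀ ht1 (by norm_num))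
        nlinarith
      have h7 : (4 * t ^ 2 + t ^ 2 / 100) * (4 * t ^ 24 + 2 * t ^ 24) =
          (24 + 6 / 100) * t ^ 26 := by
        ring
      have h8 : 0 ≤ t ^ 26 := by positivity
      rw [h7] at h4
      have h9 : (24 + 6 / 100) * t ^ 26 ≤ 25 * t ^ 26 := by nlinarith
      linarith
    have h2 : 26 * t ^ 26 ≤ D * (52 * s ^ 6) := by
      rw [e26]
      have := mul_le_mul_of_nonneg_right hD (pow_nonneg hs0.le 6)
      linarith
    linarith
  have hratio : (t ^ 24 + 2) * (1 + s ^ 3 - 2 * s ^ 6) ≤ t ^ 24 + t ^ 21 - t ^ 18 := by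
    have h3 : s ^ 3 ≤ 1 := pow_le_one₀ hs0.le (by linarith)
    have h6 : 0 ≤ s ^ 6 := by positivity
    have h18 : 4 ≤ t ^ 18 := by
      calc (4 : ℝ) ≤ t := by linarith
        _ ≤ t ^ 18 := le_self_pow₀ ht1 (by norm_num)
    have : (t ^ 24 + 2) * (1 + s ^ 3 - 2 * s ^ 6) =
        t ^ 24 + s ^ 3 * t ^ 24 - 2 * (s ^ 6 * t ^ 24) + 2 + 2 * s ^ 3 - 4 * s ^ 6 := by ring
    rw [this, e24, e18]
    linarith
  have hs3 : s ^ 3 ≤ 1 / 1000 := by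
    calc s ^ 3 ≤ (1 / 100) ^ 3 := pow_le_pow_left₀ hs0.le hs1 3
      _ ≤ 1 / 1000 := by norm_num
  have hs3' : 0 < s ^ 3 := by positivity
  -- The crux: the surplus `s ^ 3` of the old rate dominates the surplus `2 * s ^ 4` of the new rate
  -- and all losses of order `s ^ 6`.
  have hfac : 1 + 2 * s ^ 4 + s ^ 6 ≤ (1 - 52 * s ^ 6) * (1 + s ^ 3 - 2 * s ^ 6) := by
    have h4 : s ^ 4 ≤ s ^ 3 / 100 := by
      have : s ^ 4 = s ^ 3 * s := by ring
      rw [this]; nlinarith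
    have h6 : s ^ 6 ≤ s ^ 3 / 1000 := by
      have : s ^ 6 = s ^ 3 * s ^ 3 := by ring
      rw [this]; nlinarith
    have h9 : s ^ 6 * s ^ 3 ≤ s ^ 6 := by
      have : 0 ≤ s ^ 6 := by positivity
      nlinarith
    have h12 : 0 ≤ s ^ 6 * s ^ 6 := by positivity
    nlinarith
  have hfac0 : 0 ≤ 1 + s ^ 3 - 2 * s ^ 6 := by
    have h6 : s ^ 6 ≤ s ^ 3 / 1000 := by
      have : s ^ 6 = s ^ 3 * s ^ 3 := by ring
      rw [this]; nlinarith
    linarith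
  have hD0 : 0 ≤ D := le_trans (by positivity) hD
  have hmain : D * (1 + 2 * s ^ 4 + s ^ 6) ≤ N * (t ^ 24 + t ^ 21 - t ^ 18) := by
    calc D * (1 + 2 * s ^ 4 + s ^ 6)
        ≤ D * ((1 - 52 * s ^ 6) * (1 + s ^ 3 - 2 * s ^ 6)) := mul_le_mul_of_nonneg_left hfac hD0
      _ = D * (1 - 52 * s ^ 6) * (1 + s ^ 3 - 2 * s ^ 6) := by ring
      _ ≤ N * (t ^ 24 + 2) * (1 + s ^ 3 - 2 * s ^ 6) := mul_le_mul_of_nonneg_right hNlow hfac0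
      _ = N * ((t ^ 24 + 2) * (1 + s ^ 3 - 2 * s ^ 6)) := by ring
      _ ≤ N * (t ^ 24 + t ^ 21 - t ^ 18) := mul_le_mul_of_nonneg_left hratio hN
  have hstep : t + 2 * t ^ 8 - m * (1 + s ^ 3) * t ^ 24 ≤ -(m * (t ^ 24 + t ^ 21 - t ^ 18)) := by
    have : m * (1 + s ^ 3) * t ^ 24 = m * (t ^ 24 + s ^ 3 * t ^ 24) := by ring
    rw [this, e24]
    linarith
  have h1 := mul_le_mul_of_nonneg_left hstep hN
  have h2 := mul_le_mul_of_nonneg_left hmain hm0.le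
  linarith

/-- The probability bounds of the resonant and the singular events add up to the required one. -/
lemma probability_le (ht : 100 ≤ t) {v n w : ℝ} {k : ℕ} (hv0 : 0 ≤ v) (hv : v ≤ Real.exp t)
    (hn0 : 0 ≤ n) (hn : n ≤ Real.exp t) (hw0 : 0 ≤ w) (hw : 2 * w ≤ Real.exp t)
    (hk : 4 * t ^ 2 ≤ k) :
    (v * n + 1) * (v * (w * (2 * v * Real.exp (-(2 * t ^ 8))))) +
      (v * Real.exp (-t ^ 6)) ^ k ≤ Real.exp (-t ^ 8) := by
  have ht1 : 1 ≤ t := by linarith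
  have ht0 : 0 ≤ t := by linarith
  set e := Real.exp t with he
  have he3 : 3 ≤ e := by
    have := Real.add_one_le_exp t
    linarith
  have h1 : (v * n + 1) * (v * (w * (2 * v * Real.exp (-(2 * t ^ 8))))) ≤
      2 * e ^ 5 * Real.exp (-(2 * t ^ 8)) := by
    have h11 : v * n + 1 ≤ 2 * e ^ 2 := by
      have : v * n ≤ e * e := mul_le_mul hv hn hn0 (by linarith)
      nlinarith
    have h12 : v * (2 * w) * v ≤ e * e * e :=
      mul_le_mul (mul_le_mul hv hw (by linarith) (by linarith)) hv hv0 (by positivity)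
    calc _ = (v * n + 1) * (v * (2 * w) * v) * Real.exp (-(2 * t ^ 8)) := by ring
      _ ≤ (2 * e ^ 2) * (e * e * e) * Real.exp (-(2 * t ^ 8)) := by
          refine mul_le_mul_of_nonneg_right ?_ (Real.exp_pos _).le
          exact mul_le_mul h11 h12 (by positivity) (by positivity)
      _ = _ := by ring
  -- Half of `t ^ 6` absorbs the volume; `4 * t ^ 2` factors `exp (-t ^ 6 / 2)` then give `exp (-2 *
  -- t ^ 8)`, whence the number of disjoint balls.
  have h2 : (v * Real.exp (-t ^ 6)) ^ k ≤ Real.exp (-(2 * t ^ 8)) := by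
    have h6 : 2 * t ≤ t ^ 6 := by
      have : t ^ 6 = t * t ^ 5 := by ring
      have h5 : 2 ≤ t ^ 5 := by
        calc (2 : ℝ) ≤ t := by linarith
          _ ≤ t ^ 5 := le_self_pow₀ ht1 (by norm_num)
      nlinarith
    have h21 : v * Real.exp (-t ^ 6) ≤ Real.exp (-(t ^ 6 / 2)) := by
      calc v * Real.exp (-t ^ 6) ≤ e * Real.exp (-t ^ 6) :=
            mul_le_mul_of_nonneg_right hv (Real.exp_pos _).le
        _ = Real.exp (t + -t ^ 6) := (Real.exp_add _ _).symm
        _ ≤ Real.exp (-(t ^ 6 / 2)) := Real.exp_le_exp.2 (by linarith)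
    calc _ ≤ Real.exp (-(t ^ 6 / 2)) ^ k := pow_le_pow_left₀ (by positivity) h21 k
      _ = Real.exp (k * -(t ^ 6 / 2)) := (Real.exp_nat_mul _ _).symm
      _ ≤ Real.exp (-(2 * t ^ 8)) := by
          refine Real.exp_le_exp.2 ?_
          have := mul_le_mul_of_nonneg_right hk (show 0 ≤ t ^ 6 / 2 by positivity)
          nlinarith
  calc _ ≤ 2 * e ^ 5 * Real.exp (-(2 * t ^ 8)) + Real.exp (-(2 * t ^ 8)) := add_le_add h1 h2
    _ = (2 * e ^ 5 + 1) * Real.exp (-(2 * t ^ 8)) := by ring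
    _ ≤ e ^ 6 * Real.exp (-(2 * t ^ 8)) := by
        refine mul_le_mul_of_nonneg_right ?_ (Real.exp_pos _).le
        have : 1 ≤ e ^ 5 := one_le_pow₀ (by linarith)
        have h6 : e ^ 6 = e * e ^ 5 := by ring
        rw [h6]
        nlinarith
    _ = Real.exp (6 * t + -(2 * t ^ 8)) := by
        rw [Real.exp_add, he, ← Real.exp_nat_mul]
        norm_num
    _ ≤ Real.exp (-t ^ 8) := by
        refine Real.exp_le_exp.2 ?_
        have : t ^ 8 = t * t ^ 7 := by ring
        have h7 : 6 ≤ t ^ 7 := by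
          calc (6 : ℝ) ≤ t := by linarith
            _ ≤ t ^ 7 := le_self_pow₀ ht1 (by norm_num)
        nlinarith

end Scales

/-! ### The induction step -/

section InductionStep

variable {Z : Type*} {𝒵 : SimpleGraph Z} {C d C_W m₀ m t E : ℝ} {L n : ℕ}

lemma γ_le {L' : ℕ} (ht : 0 < t) (hm : 0 ≤ m) (hL' : t ^ 32 / 2 ≤ L') :
    γ m L' ≤ m * (1 + 2 * t⁻¹ ^ 4) := by
  have h1 : (t ^ 4 / 2) ^ 8 ≤ (L' : ℝ) := by
    refine le_trans ?_ hL'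
    have : 0 ≤ t ^ 32 := by positivity
    ring_nf
    linarith
  have h2 : (L' : ℝ) ^ (-τ) ≤ 2 * t⁻¹ ^ 4 := by
    calc (L' : ℝ) ^ (-τ) ≤ ((t ^ 4 / 2) ^ 8) ^ (-τ) :=
          Real.rpow_le_rpow_of_nonpos (by positivity) h1 (by norm_num [τ])
      _ = (t ^ 4 / 2) ^ (-1 : ℝ) := pow_rpow_eq (by positivity) 8 _ _ (by norm_num [τ])
      _ = 2 * t⁻¹ ^ 4 := by
          rw [Real.rpow_neg_one, inv_div, inv_pow]
          rfl
  exact mul_le_mul_of_nonneg_left (by linarith) hm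

lemma γ_eq (ht : 0 ≤ t) (hL : (L : ℝ) = t ^ 24) : γ m L = m * (1 + t⁻¹ ^ 3) := by
  rw [γ, hL, pow_rpow_eq ht 24 (-τ) (-3) (by norm_num [τ]), Real.rpow_neg ht, inv_pow]
  norm_num

/-- The deterministic part of the induction step. -/
lemma isNonsingular_of_few_singular {V : Z → ℝ} {G : Set Z} {Λ : Finset Z} {L' : ℕ}
    (hgr : PolynomialGrowth 𝒵 C d) (hC : 0 < C) (hCt : C ≤ Real.exp t) (hm₀ : 0 < m₀)
    (hm : m₀ ≤ m) (hbig : IsLarge d C C_W m₀ t) (hL : (L : ℝ) = t ^ 24)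
    (hL' : t ^ 32 / 2 ≤ L') (hvol : C ^ 2 * (L' : ℝ) ^ d ≤ Real.exp t)
    (hn : (n : ℝ) ≤ 4 * t ^ 2 + 1) (hconn : (𝒵.induce (Λ : Set Z)).Connected)
    (hsub : (Λ : Set Z) ⊆ G)
    (hdiam : ∀ x ∈ Λ, ∀ y ∈ Λ, relDist 𝒵 G x y ≤ 2 * L')
    (hΛ : IsNonresonant 𝒵 V E (Real.exp (-(2 * t ^ 8))) Λ)
    (hball : ∀ x ∈ Λ, ∀ r < 2 * L',
      IsNonresonant 𝒵 V E (Real.exp (-(2 * t ^ 8))) (finBall 𝒵 Λ x r))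
    (hsing : ∀ s ⊆ Λ, s.card = n → (s : Set Z).PairwiseDisjoint (fun c => finBall 𝒵 Λ c L) →
      ∃ c ∈ s, IsNonsingular 𝒵 C d V E m (Λ : Set Z) L (finBall 𝒵 Λ c L)) :
    IsNonsingular 𝒵 C d V E m G L' Λ := by
  have ht0 : 0 < t := by linarith [hbig.large]
  have hL1 : 1 ≤ L := by
    have : (1 : ℝ) ≤ L := by
      rw [hL]
      exact one_le_pow₀ (by linarith [hbig.large])
    exact_mod_cast this
  refine ⟨hΛ.notMem_spectrum (Real.exp_pos _), fun x y hxy => ?_⟩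
  rw [range_exponent, Real.rpow_one] at hxy
  -- The iteration uses the metric of `Λ`, whereas the required decay is in that of `G`. The former
  -- distance is the larger one, so the `G`-distance is an admissible `D`.
  obtain ⟨N, hN, hDN⟩ := exists_greenFunction_decay hgr hC hL1 (Real.exp_pos _) hconn x y
    (relDist_anti hconn hsub x.2 y.2) hΛ
    (fun r hr => hball x x.2 r (hr.trans_le (hdiam x x.2 y y.2))) hsing
  set D := relDist 𝒵 G x y with hD
  have hDN' : (D : ℝ) ≤ N * (t ^ 24 + 2) + n * (4 * t ^ 24 + 2) + t ^ 24 + 1 := by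
    rw [← hL]
    exact_mod_cast hDN
  have hexp := exponent_le hbig.large hbig.mass hm₀ hm (Nat.cast_nonneg N) hn (hL'.trans hxy) hDN'
  have hγ := γ_le ht0 (hm₀.le.trans hm) hL'
  rw [γ_eq ht0.le hL, hL] at hN
  have hinv : 1 / Real.exp (-(2 * t ^ 8)) = Real.exp (2 * t ^ 8) := by
    rw [Real.exp_neg, one_div, inv_inv]
  have hq : C / Real.exp (-(2 * t ^ 8)) * Real.exp (-(m * (1 + t⁻¹ ^ 3) * t ^ 24)) ≤
      Real.exp (t + 2 * t ^ 8 - m * (1 + t⁻¹ ^ 3) * t ^ 24) := by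
    rw [div_eq_mul_one_div, hinv, sub_eq_add_neg, Real.exp_add, Real.exp_add]
    exact mul_le_mul_of_nonneg_right
      (mul_le_mul_of_nonneg_right hCt (Real.exp_pos _).le) (Real.exp_pos _).le
  calc C ^ 2 * (L' : ℝ) ^ d * |greenFunction 𝒵 V Λ E x y|
      ≤ Real.exp t * (Real.exp (t + 2 * t ^ 8 - m * (1 + t⁻¹ ^ 3) * t ^ 24) ^ N *
          Real.exp (2 * t ^ 8)) := by
        refine mul_le_mul hvol (hN.trans ?_) (abs_nonneg _) (Real.exp_pos _).le
        rw [hinv]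
        exact mul_le_mul_of_nonneg_right (pow_le_pow_left₀ (by positivity) hq N)
          (Real.exp_pos _).le
    _ = Real.exp (t + N * (t + 2 * t ^ 8 - m * (1 + t⁻¹ ^ 3) * t ^ 24) + 2 * t ^ 8) := by
        rw [Real.exp_add, Real.exp_add t, Real.exp_nat_mul]
        ring
    _ ≤ Real.exp (-(γ m L' * D)) := by
        refine Real.exp_le_exp.2 (hexp.trans (neg_le_neg ?_))
        exact mul_le_mul_of_nonneg_right hγ (Nat.cast_nonneg D)

variable {Ω : Type*} [MeasurableSpace Ω] {μ : Measure Ω} [IsProbabilityMeasure μ]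
  {V : Z → Ω → ℝ}

/-- It is unlikely that a finite set or one of the balls in it is resonant. -/
lemma IsIIDPotential.measureReal_exists_resonant_le (hV : IsIIDPotential μ V C_W) (hC : 0 ≤ C_W)
    {ε : ℝ} (hε : 0 ≤ ε) (Λ : Finset Z) (R : ℕ) :
    μ.real {ω | ¬ IsNonresonant 𝒵 (fun z => V z ω) E ε Λ ∨
      ∃ x ∈ Λ, ∃ r < R, ¬ IsNonresonant 𝒵 (fun z => V z ω) E ε (finBall 𝒵 Λ x r)} ≤
      (Λ.card * R + 1) * (Λ.card * (C_W * (2 * Λ.card * ε))) := by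
  have hmono : ∀ Λ' ⊆ Λ, μ.real {ω | ¬ IsNonresonant 𝒵 (fun z => V z ω) E ε Λ'} ≤
      Λ.card * (C_W * (2 * Λ.card * ε)) := by
    intro Λ' h
    have hcard : (Λ'.card : ℝ) ≤ Λ.card := by exact_mod_cast Finset.card_le_card h
    refine (hV.measure_not_isNonresonant_le hC hε Λ').trans ?_
    gcongr
  calc _ ≤ μ.real ({ω | ¬ IsNonresonant 𝒵 (fun z => V z ω) E ε Λ} ∪
        ⋃ p ∈ Λ ×ˢ Finset.range R,
          {ω | ¬ IsNonresonant 𝒵 (fun z => V z ω) E ε (finBall 𝒵 Λ p.1 p.2)}) := by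
        refine measureReal_mono ?_ (measure_ne_top _ _)
        rintro ω (h | ⟨x, hx, r, hr, h⟩)
        · exact Or.inl h
        · refine Or.inr ?_
          simp only [Set.mem_iUnion]
          exact ⟨(x, r), by simp [hx, hr], h⟩
    _ ≤ μ.real {ω | ¬ IsNonresonant 𝒵 (fun z => V z ω) E ε Λ} +
        ∑ p ∈ Λ ×ˢ Finset.range R,
          μ.real {ω | ¬ IsNonresonant 𝒵 (fun z => V z ω) E ε (finBall 𝒵 Λ p.1 p.2)} :=
        (measureReal_union_le _ _).trans
          (add_le_add_right (measureReal_biUnion_finset_le _ _) _)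
    _ ≤ Λ.card * (C_W * (2 * Λ.card * ε)) +
        ∑ _p ∈ Λ ×ˢ Finset.range R, Λ.card * (C_W * (2 * Λ.card * ε)) :=
        add_le_add (hmono Λ subset_rfl)
          (Finset.sum_le_sum fun p _ => hmono _ (finBall_subset _ _))
    _ = _ := by
        rw [Finset.sum_const, Finset.card_product, Finset.card_range, nsmul_eq_mul]
        push_cast
        ring

/-- The induction step, from the scale `L` to the scale `⌊L ^ α⌋`. -/
lemma SingularBound.step (h𝒵 : 𝒵.Connected) (hgr : PolynomialGrowth 𝒵 C d)
    (hV : IsIIDPotential μ V C_W) (hC_W : 0 ≤ C_W) (hm₀ : 0 < m₀) (hm : m₀ ≤ m)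
    (hbig : IsLarge d C C_W m₀ ((L : ℝ) ^ (1 / 24 : ℝ))) (h : SingularBound 𝒵 C d μ V m L E) :
    SingularBound 𝒵 C d μ V m ⌊(L : ℝ) ^ α⌋₊ E := by
  intro G hG u hu Λ hΛ
  have : Nonempty Z := h𝒵.nonempty
  have hC1 : 1 ≤ C := hgr.one_le
  set t := (L : ℝ) ^ (1 / 24 : ℝ) with ht
  have ht100 := hbig.large
  have ht0 : 0 ≤ t := by linarith
  have ht1 : 1 ≤ t := by linarith
  have hL : (L : ℝ) = t ^ 24 := by
    rw [ht, ← Real.rpow_natCast, ← Real.rpow_mul (Nat.cast_nonneg L)]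
    norm_num
  have hLα : (L : ℝ) ^ α = t ^ 32 := by
    rw [hL, pow_rpow_eq ht0 24 α 32 (by norm_num [α])]
    norm_num
  rw [hLα] at hΛ ⊢
  set L' := ⌊t ^ 32⌋₊ with hL'
  have hL'le : (L' : ℝ) ≤ t ^ 32 := Nat.floor_le (by positivity)
  have h32 : 2 ≤ t ^ 32 := by
    calc (2 : ℝ) ≤ t := by linarith
      _ ≤ t ^ 32 := le_self_pow₀ ht1 (by norm_num)
  have hL'ge : t ^ 32 / 2 ≤ L' := by
    have := Nat.lt_floor_add_one (t ^ 32)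
    rw [← hL'] at this
    linarith
  have hL'1 : (1 : ℝ) ≤ L' := by linarith
  have hmem : ∀ y, y ∈ Λ ↔ y ∈ G ∧ relDist 𝒵 G u y ≤ L' := fun y => by
    rw [← Finset.mem_coe, hΛ]; rfl
  have hsub : (Λ : Set Z) ⊆ G := fun y hy => ((hmem y).1 hy).1
  have hconn : (𝒵.induce (Λ : Set Z)).Connected := by
    rw [hΛ]; exact connected_induce_relBall hG hu L'
  have hdiam : ∀ x ∈ Λ, ∀ y ∈ Λ, relDist 𝒵 G x y ≤ 2 * L' := by
    intro x hx y hy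
    have h1 := relDist_triangle (z := y) hG (hsub hx) hu
    have h2 := ((hmem x).1 hx).2
    have h3 := ((hmem y).1 hy).2
    rw [relDist_comm x u] at h1
    omega
  -- Replacing `L'` by the larger `t ^ 32` requires a nonnegative exponent, hence `max d 0`.
  have hpow : (L' : ℝ) ^ d ≤ (t ^ 32) ^ max d 0 :=
    (Real.rpow_le_rpow_of_exponent_le hL'1 (le_max_left d 0)).trans
      (Real.rpow_le_rpow (by linarith) hL'le (le_max_right d 0))
  have hvol : C ^ 2 * (L' : ℝ) ^ d ≤ Real.exp t := by
    refine le_trans ?_ hbig.volume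
    rw [max_eq_left hC1]
    exact mul_le_mul_of_nonneg_left hpow (by positivity)
  have hLd0 : 0 ≤ (L' : ℝ) ^ d := by positivity
  have hcard : (Λ.card : ℝ) ≤ Real.exp t := by
    refine (hgr.card_relBall_le hG hu (by exact_mod_cast hL'1) hΛ).trans (le_trans ?_ hvol)
    exact mul_le_mul_of_nonneg_right (le_self_pow₀ hC1 two_ne_zero) hLd0
  have hCt : C ≤ Real.exp t := by
    refine le_trans ?_ hbig.volume
    rw [max_eq_left hC1]
    have h1 : 1 ≤ (t ^ 32) ^ max d 0 := Real.one_le_rpow (by linarith) (le_max_right d 0)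
    nlinarith
  set n := ⌈4 * t ^ 2⌉₊ with hn
  have hn1 : (n : ℝ) ≤ 4 * t ^ 2 + 1 := (Nat.ceil_lt_add_one (by positivity)).le
  have hn2 : 4 * t ^ 2 ≤ n := Nat.le_ceil _
  have hLδ : (L : ℝ) ^ δ = t ^ 6 := by
    rw [hL, pow_rpow_eq ht0 24 δ 6 (by norm_num [δ])]
    norm_num
  have hL'δ : (L' : ℝ) ^ δ ≤ t ^ 8 := by
    calc (L' : ℝ) ^ δ ≤ (t ^ 32) ^ δ :=
          Real.rpow_le_rpow (Nat.cast_nonneg _) hL'le (by norm_num [δ])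
      _ = t ^ 8 := by
          rw [pow_rpow_eq ht0 32 δ 8 (by norm_num [δ])]
          norm_num
  have hres := hV.measureReal_exists_resonant_le (𝒵 := 𝒵) (E := E) hC_W
    (Real.exp_pos (-(2 * t ^ 8))).le Λ (2 * L')
  have hsing := hV.measureReal_exists_disjoint_singular_le (𝒵 := 𝒵) (C := C) (d := d) (E := E)
    (m := m) (L := L) (Λ := Λ) (n := n) (Real.exp_pos (-t ^ 6)).le fun c hc => by
      rw [← hLδ]
      exact h Λ hconn c hc _ (coe_finBall c L)
  have htotal := probability_le ht100 (Nat.cast_nonneg Λ.card) hcard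
    (Nat.cast_nonneg (2 * L'))
    (le_trans (by push_cast; linarith) hbig.radii) hC_W hbig.density hn2
  refine le_trans ?_ ((add_le_add hres hsing).trans
    (htotal.trans (Real.exp_le_exp.2 (neg_le_neg hL'δ))))
  refine (measureReal_mono ?_ (measure_ne_top _ _)).trans (measureReal_union_le _ _)
  intro ω hω
  by_contra hcon
  rw [Set.mem_union, not_or] at hcon
  obtain ⟨hcon1, hcon2⟩ := hcon
  simp only [Set.mem_ofPred_eq, not_or, not_not, not_exists, not_and] at hcon1 hcon2
  refine hω (isNonsingular_of_few_singular hgr (by linarith) hCt hm₀ hm hbig hL hL'ge hvol hn1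
    hconn hsub hdiam hcon1.1 (fun x hx r hr => hcon1.2 x hx r hr) fun s hs hsn hsd => ?_)
  by_contra! hall
  exact hcon2 s hs hsn hsd hall

end InductionStep

end FixedEnergyMSA

theorem mainTheorem5 (d C_d C_W m₀ : ℝ) (hC_W : 0 < C_W) (hm₀ : 0 < m₀) :
    ∃ Lmin : ℕ,
      ∀ (Z : Type*) (𝒵 : SimpleGraph Z), 𝒵.Connected →
        FixedEnergyMSA.PolynomialGrowth 𝒵 C_d d →
      ∀ (Ω : Type*) (_ : MeasurableSpace Ω) (μ : Measure Ω), IsProbabilityMeasure μ →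
      ∀ V : Z → Ω → ℝ, FixedEnergyMSA.IsIIDPotential μ V C_W →
      ∀ m : ℝ, m₀ ≤ m →
      ∀ L₀ : ℕ, Lmin ≤ L₀ →
      ∀ (k : ℕ) (E : ℝ),
        FixedEnergyMSA.SingularBound 𝒵 C_d d μ V m (FixedEnergyMSA.scale L₀ k) E →
        FixedEnergyMSA.SingularBound 𝒵 C_d d μ V m (FixedEnergyMSA.scale L₀ (k + 1)) E := by
  obtain ⟨Lmin, hLmin⟩ :=
    Filter.eventually_atTop.1 (FixedEnergyMSA.eventually_isLarge d C_d C_W hm₀)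
  -- From `1` on the scales do not decrease, so every `scale L₀ k` stays above `Lmin`.
  refine ⟨max Lmin 1, ?_⟩
  intro Z 𝒵 h𝒵 hgr Ω _ μ hμ V hV m hm L₀ hL₀ k E h
  have hscale : Lmin ≤ FixedEnergyMSA.scale L₀ k :=
    ((le_max_left _ _).trans hL₀).trans
      (FixedEnergyMSA.le_scale ((le_max_right _ _).trans hL₀) k)
  exact FixedEnergyMSA.SingularBound.step h𝒵 hgr hV hC_W.le hm₀ hm (hLmin _ hscale) h
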